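/- Let $\mathrm{GF}(q)$ be a finite field with $q\neq 2$, and let $D,N$ be integers with $N>2D\ge 6$. Let $\Gamma$ be the bilinear forms graph $H_q(D,N-D)$: its vertex set $X$ is the set of $D\times(N-D)$ matrices over $\mathrm{GF}(q)$, and two vertices are adjacent whenever their difference has rank one. Let $\partial$ be the path-length distance, $\Gamma_i(x)=\{z\in X:\partial(x,z)=i\}$ and $\Gamma(x)=\Gamma_1(x)$. Let $V=\mathbb R^X$, let $\hat x\in V$ be the vector with $x$-coordinate $1$ and all other coordinates $0$, and put $\widehat\Omega=\sum_{z\in\Omega}\hat z$ for $\Omega\subseteq X$. Let $\theta_0>\theta_1>\cdots>\theta_D$ be the eigenvalues of the adjacency matrix $A$ of $\Gamma$, and let $E$ be the primitive idempotent associated with $\theta_1$, i.e. the real matrix acting as the identity on the $\theta_1$-eigenspace of $A$ and as $0$ on every other eigenspace. Let $\theta^*_i=|X|E_{x,y}$ for any $x,y\in X$ with $\partial(x,y)=i$. On $EV$ let $\star$ be the Norton product $u\star v=E(u\circ v)$, where $\circ$ is the entrywise product. Fix $x,y\in X$ whose distance $k=\partial(x,y)$ satisfies $2\le k\le D-1$.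 Let $\{O_i\}_{i=1}^6$ be the $y$-partition of $\Gamma(x)$: $O_1=\Gamma(x)\cap\Gamma_{k-1}(y)$, $O_6=\Gamma(x)\cap\Gamma_{k+1}(y)$, and for $2\le i\le 5$ the set $O_i$ consists of the $z\in\Gamma(x)\cap\Gamma_k(y)$ such that the pair $$\bigl(|\Gamma(x)\cap\Gamma(z)\cap\Gamma_{k-1}(y)|,\ |\Gamma(x)\cap\Gamma(z)\cap\Gamma_{k+1}(y)|\bigr)$$ equals $(2q^{k-1},0)$, $(2q^{k-1}-1,0)$, $(q^{k-1},q^D-q^k)$, $(q^{k-1},q^{N-D}-q^k)$ for $i=2,3,4,5$ respectively. Let $\{O'_i\}_{i=1}^6$ be the $x$-partition of $\Gamma(y)$, defined in the same way with $x$ and $y$ interchanged. Let $$\lambda_i=|O_i|\,\frac{\theta^*_1-\theta^*_{k+\varepsilon(i)}}{\theta^*_0-\theta^*_k}\quad(1\le i\le 6),\qquad \varepsilon(1)=-1,\ \varepsilon(2)=\cdots=\varepsilon(5)=0,\ \varepsilon(6)=1,$$ let $O_i^\vee=\widehat O_i-\lambda_i\hat x$, and let $\mathrm{Sym}(S)=\mathrm{Span}\{EO_i^\vee: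 1\le i\le 6\}$. Define $$\omega_1=\omega_3=\frac{(q^D-q^k)(q^{N-D}-q^k)(q^{k-1}-1)}{q^k(q-1)},\qquad \omega_2=\frac{(q^D-q^k)(q^{N-D}-q^k)}{q(q-1)},$$ $$\omega_4=-\frac{(q^D-q^k)(q^{k-1}-1)}{q-1},\qquad \omega_5=-\frac{(q^{N-D}-q^k)(q^{k-1}-1)}{q-1},\qquad \omega_6=\frac{(q^k-1)(q^{k-1}-1)}{q-1},$$ and $$h_6=\sum_{i=1}^6\omega_iE\widehat O_i,\qquad h'_6=\sum_{i=1}^6\omega_iE\widehat O'_i,\qquad h_6^\vee=h_6-\mu_6E\hat x,\quad \mu_6=\sum_{i=1}^6\lambda_i\omega_i .$$ Then $h_6^\vee=h_6=h'_6$. Denote this common vector by $\omega=\omega(x,y)$. It lies in $\mathrm{Sym}(S)$, it satisfies $\omega(x,y)=\omega(y,x)$, and $$E\hat x\star\omega=-q|X|^{-1}\omega,\qquad E\hat y\star\omega=-q|X|^{-1}\omega .$$ -/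

import Mathlib

open Matrix

namespace BilForms

section Generic

variable {X : Type*} [Fintype X] [DecidableEq X]

/-- The set of eigenvalues of a real square matrix: the roots of its minimal polynomial. -/
noncomputable def eigenvalueFinset (A : Matrix X X ℝ) : Finset ℝ :=
  (minpoly ℝ A).roots.toFinset

/-- The distinct eigenvalues listed in decreasing order, `θ₀ > θ₁ > ⋯` (the value is `0` beyond
the end of the list). -/
noncomputable def theta (A : Matrix X X ℝ) (i : ℕ) : ℝ :=
  ((eigenvalueFinset A).sort (· ≥ ·)).getD i 0

/-- `E` acts as the identity on the `θ`-eigenspace of `A` and as `0` on every other eigenspace. -/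
def IsPrimitiveIdempotent (A : Matrix X X ℝ) (θ : ℝ) (E : Matrix X X ℝ) : Prop :=
  (∀ v : X → ℝ, A *ᵥ v = θ • v → E *ᵥ v = v) ∧
    ∀ η : ℝ, η ≠ θ → ∀ v : X → ℝ, A *ᵥ v = η • v → E *ᵥ v = 0

/-- The primitive idempotent of `A` associated with `θ`, built as the matrix
`∏ (A - η) / (θ - η)`, the product being over the eigenvalues `η ≠ θ`. For a symmetric matrix it
is the unique matrix with the property `IsPrimitiveIdempotent`, as the two theorems below show. -/
noncomputable def primitiveIdempotent (A : Matrix X X ℝ) (θ : ℝ) : Matrix X X ℝ :=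
  Polynomial.aeval A (Lagrange.basis (eigenvalueFinset A) id θ)

theorem mem_eigenvalueFinset {A : Matrix X X ℝ} {η : ℝ} {v : X → ℝ} (hv : v ≠ 0)
    (h : A *ᵥ v = η • v) : η ∈ eigenvalueFinset A := by
  have h1 : Module.End.HasEigenvalue (toLin' A) η :=
    Module.End.hasEigenvalue_of_hasEigenvector
      (x := v) ⟨Module.End.mem_eigenspace_iff.2 (by simpa using h), hv⟩
  have h2 := Module.End.isRoot_of_hasEigenvalue h1
  rw [minpoly_toLin'] at h2
  rw [eigenvalueFinset, Multiset.mem_toFinset, Polynomial.mem_roots']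
  exact ⟨minpoly.ne_zero (Algebra.IsIntegral.isIntegral A), h2⟩

theorem aeval_mulVec {A : Matrix X X ℝ} {η : ℝ} {v : X → ℝ} (h : A *ᵥ v = η • v)
    (p : Polynomial ℝ) : (Polynomial.aeval A p) *ᵥ v = p.eval η • v := by
  have h1 := Module.End.aeval_apply_of_mem_apply_eq_smul (f := toLin' A) (p := p)
    (x := v) (μ := η) (by simpa using h)
  rw [← h1, ← toLinAlgEquiv'_apply, ← Polynomial.aeval_algHom_apply]
  rfl

theorem isPrimitiveIdempotent_primitiveIdempotent (A : Matrix X X ℝ) (θ : ℝ) :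
    IsPrimitiveIdempotent A θ (primitiveIdempotent A θ) := by
  refine ⟨fun v h => ?_, fun η hη v h => ?_⟩
  · by_cases hv : v = 0
    · simp [hv]
    have := Lagrange.eval_basis_self (v := (id : ℝ → ℝ)) (Set.injOn_id _)
      (mem_eigenvalueFinset hv h)
    rw [primitiveIdempotent, aeval_mulVec h]
    simp only [id] at this
    rw [this, one_smul]
  · by_cases hv : v = 0
    · simp [hv]
    have := Lagrange.eval_basis_of_ne (v := (id : ℝ → ℝ)) hη.symm (mem_eigenvalueFinset hv h)
    rw [primitiveIdempotent, aeval_mulVec h]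
    simp only [id] at this
    rw [this, zero_smul]

theorem IsPrimitiveIdempotent.unique {A : Matrix X X ℝ} (hA : A.IsSymm) {θ : ℝ}
    {E E' : Matrix X X ℝ} (h : IsPrimitiveIdempotent A θ E) (h' : IsPrimitiveIdempotent A θ E') :
    E = E' := by
  have hH : A.IsHermitian := by
    rw [IsHermitian, conjTranspose_eq_transpose_of_trivial]; exact hA
  have key : (toLin' E) ∘ₗ (WithLp.linearEquiv 2 ℝ (X → ℝ)).toLinearMap =
      (toLin' E') ∘ₗ (WithLp.linearEquiv 2 ℝ (X → ℝ)).toLinearMap := by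
    refine hH.eigenvectorBasis.toBasis.ext fun j => ?_
    have hj := hH.mulVec_eigenvectorBasis j
    simp only [OrthonormalBasis.coe_toBasis, LinearMap.comp_apply, LinearEquiv.coe_coe,
      toLin'_apply]
    change E *ᵥ (hH.eigenvectorBasis j).ofLp = E' *ᵥ (hH.eigenvectorBasis j).ofLp
    by_cases hθ : hH.eigenvalues j = θ
    · rw [hθ] at hj
      rw [h.1 _ hj, h'.1 _ hj]
    · rw [h.2 _ hθ _ hj, h'.2 _ hθ _ hj]
  apply (toLin' (R := ℝ)).injective
  ext1 i
  exact LinearMap.ext fun c => by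
    simpa using LinearMap.congr_fun key (WithLp.toLp 2 (Pi.single i c))

/-- The vector `x̂` with `x`-coordinate `1` and all other coordinates `0`. -/
def hat (x : X) : X → ℝ := Pi.single x 1

/-- The characteristic vector `Ω̂ = ∑ x̂`, the sum being over `x ∈ Ω`. -/
def hatSet (Ω : Finset X) : X → ℝ := ∑ z ∈ Ω, hat z

/-- The Norton product `u ⋆ v = E (u ∘ v)`, where `∘` is the entrywise product. The Norton algebra
is the subspace `EV` of `V = ℝ^X` with this product; it is only used for `u, v ∈ EV`. -/
def norton (E : Matrix X X ℝ) (u v : X → ℝ) : X → ℝ := E *ᵥ (u * v)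

end Generic

section BilinearForms

/-- The `D × (N - D)` matrices over `F`. -/
abbrev Vertex (F : Type*) (D N : ℕ) : Type _ := Matrix (Fin D) (Fin (N - D)) F

variable (F : Type*) [Field F] [Fintype F] (D N : ℕ)

/-- The bilinear forms graph `H_q(D, N - D)`: two matrices are adjacent whenever their difference
has rank one. -/
def graph : SimpleGraph (Vertex F D N) where
  Adj x y := (x - y).rank = 1
  symm := ⟨fun x y h => by
    have e : y - x = (-1 : F) • (x - y) := by simp
    rw [e, rank_smul_of_mem_nonZeroDivisors _ (by simp)]
    exact h⟩
  loopless := ⟨fun x h => by simp at h⟩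

/-- The path-length distance of the bilinear forms graph. -/
noncomputable def dist (x y : Vertex F D N) : ℕ := (graph F D N).dist x y

open Classical in
/-- The adjacency matrix of the bilinear forms graph. -/
noncomputable def adjMat : Matrix (Vertex F D N) (Vertex F D N) ℝ := (graph F D N).adjMatrix ℝ

open Classical in
/-- The primitive idempotent `E` associated with the second largest eigenvalue `θ₁`. -/
noncomputable def E : Matrix (Vertex F D N) (Vertex F D N) ℝ :=
  primitiveIdempotent (adjMat F D N) (theta (adjMat F D N) 1)

open Classical in
/-- The dual eigenvalue `θ*ᵢ = |X| E_{x,y}` for any `x, y` at distance `i` (the entry of `E`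
depends only on the distance); the value is `0` if no two vertices are at distance `i`. -/
noncomputable def dualEigenvalue (i : ℕ) : ℝ :=
  if h : ∃ p : Vertex F D N × Vertex F D N, dist F D N p.1 p.2 = i then
    (Fintype.card (Vertex F D N) : ℝ) * E F D N h.choose.1 h.choose.2
  else 0

variable {F}

open Classical in
/-- The set `Γ_i(x)` of vertices at distance `i` from `x`. -/
noncomputable def sphere (i : ℕ) (x : Vertex F D N) : Finset (Vertex F D N) :=
  {z | dist F D N x z = i}

open Classical in
/-- The set of `z ∈ Γ(x) ∩ Γ_k(y)`, `k = ∂(x,y)`, such that `|Γ(x) ∩ Γ(z) ∩ Γ_{k-1}(y)| = a` and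
`|Γ(x) ∩ Γ(z) ∩ Γ_{k+1}(y)| = b`. -/
noncomputable def midPart (x y : Vertex F D N) (a b : ℤ) : Finset (Vertex F D N) :=
  let k := dist F D N x y
  {z ∈ sphere D N 1 x ∩ sphere D N k y |
    ((sphere D N 1 x ∩ sphere D N 1 z ∩ sphere D N (k - 1) y).card : ℤ) = a ∧
    ((sphere D N 1 x ∩ sphere D N 1 z ∩ sphere D N (k + 1) y).card : ℤ) = b}

open Classical in
/-- The `y`-partition `O₁, …, O₆` of `Γ(x)`, where `k = ∂(x,y)` (indices are shifted to
`0, …, 5`). -/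
noncomputable def part (x y : Vertex F D N) : Fin 6 → Finset (Vertex F D N) :=
  let q : ℤ := Fintype.card F
  let k := dist F D N x y
  ![sphere D N 1 x ∩ sphere D N (k - 1) y,
    midPart D N x y (2 * q ^ (k - 1)) 0,
    midPart D N x y (2 * q ^ (k - 1) - 1) 0,
    midPart D N x y (q ^ (k - 1)) (q ^ D - q ^ k),
    midPart D N x y (q ^ (k - 1)) (q ^ (N - D) - q ^ k),
    sphere D N 1 x ∩ sphere D N (k + 1) y]

open Classical in
/-- `E Ô_i` for the `y`-partition of `Γ(x)`. For the vectors `E Ô'_i` exchange `x` and `y`. -/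
noncomputable def EO (x y : Vertex F D N) (i : Fin 6) : Vertex F D N → ℝ :=
  E F D N *ᵥ hatSet (part D N x y i)

open Classical in
/-- `E x̂`. -/
noncomputable def Ehat (x : Vertex F D N) : Vertex F D N → ℝ := E F D N *ᵥ hat x

/-- The scalar `λ_i = |O_i| (θ*₁ - θ*_{k+ε(i)}) / (θ*₀ - θ*_k)`, where `ε = (-1,0,0,0,0,1)`. -/
noncomputable def lam (x y : Vertex F D N) (i : Fin 6) : ℝ :=
  let k := dist F D N x y
  (part D N x y i).card *
    (dualEigenvalue F D N 1 - dualEigenvalue F D N ((![k - 1, k, k, k, k, k + 1] : Fin 6 → ℕ) i)) /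
    (dualEigenvalue F D N 0 - dualEigenvalue F D N k)

open Classical in
/-- The symmetric part `Sym(S)`: the span of the vectors `E O^∨_i`, where
`O^∨_i = Ô_i - λ_i x̂`. -/
noncomputable def symS (x y : Vertex F D N) : Submodule ℝ (Vertex F D N → ℝ) :=
  Submodule.span ℝ
    (Set.range fun i : Fin 6 => E F D N *ᵥ (hatSet (part D N x y i) - lam D N x y i • hat x))

/-- The `6 × 6` matrix `H` (rows and columns are indexed by `0, …, 5`). -/
noncomputable def H (q : ℝ) (D N k : ℕ) : Matrix (Fin 6) (Fin 6) ℝ :=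
  let a := q ^ D - q ^ k
  let b := q ^ (N - D) - q ^ k
  let c := q ^ k - 1
  let c' := q ^ (k - 1) - 1
  let r := q - 1
  let s := (q ^ N - q ^ (N - D + 1) - q ^ (D + 1) + q ^ (k + 1) - q ^ k + q) / r ^ 2
  !![1, a / r, b / r, q - 2, s, a * b * c' / (q ^ k * r);
     1, a / r, b / r, 0, (q ^ k - q ^ N) / r, a * b / (q * r);
     1, a / r, b / r, -1, s, a * b * c' / (q ^ k * r);
     1, a / r, -(c / r), 0, (q ^ k - q ^ D) / r, -(a * c' / r);
     1, -(c / r), b / r, 0, (q ^ k - q ^ (N - D)) / r, -(b * c' / r);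
     1, -(c / r), -(c / r), 0, c / r, c * c' / r]

/-- The matrix `H` for the vertices `x, y`, with `q = |F|` and `k = ∂(x,y)`. -/
noncomputable def Hxy (x y : Vertex F D N) : Matrix (Fin 6) (Fin 6) ℝ :=
  H (Fintype.card F) D N (dist F D N x y)

/-- `h_j = ∑ i, H_{i,j} E Ô_i`. -/
noncomputable def h (x y : Vertex F D N) (j : Fin 6) : Vertex F D N → ℝ :=
  ∑ i, Hxy D N x y i j • EO D N x y i

/-- `h'_j = ∑ i, H_{i,j} E Ô'_i`, where `O'₁, …, O'₆` is the `x`-partition of `Γ(y)`. -/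
noncomputable def h' (x y : Vertex F D N) (j : Fin 6) : Vertex F D N → ℝ :=
  ∑ i, Hxy D N x y i j • EO D N y x i

/-- `μ_j = ∑ i, λ_i H_{i,j}`. -/
noncomputable def mu (x y : Vertex F D N) (j : Fin 6) : ℝ :=
  ∑ i, lam D N x y i * Hxy D N x y i j

/-- `h^∨_j = h_j - μ_j E x̂`. -/
noncomputable def hCheck (x y : Vertex F D N) (j : Fin 6) : Vertex F D N → ℝ :=
  h D N x y j - mu D N x y j • Ehat D N x

/-- `ω = ω(x,y) = h^∨₆`. -/
noncomputable def omega (x y : Vertex F D N) : Vertex F D N → ℝ := hCheck D N x y 5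

end BilinearForms

end BilForms

/-! Distance is the rank of the difference, so the graph is a Cayley graph on the additive group of
matrices, diagonalized by the characters `chi ψ C`. The eigenvalue of `chi ψ C` depends only on the
rank of `C` and decreases strictly with it. Hence `θ₁` belongs to the `C` of rank one, and the entry
of `E` at `(x, y)` is `|X|⁻¹` times the sum of `chi ψ C (x - y)` over these `C` (`E_eq_idem`,
`idem_apply`).

Put `a = y - x`. The cell containing `x + B` records whether the column and row spaces of the
rank-one matrix `B` lie in those of `a`, and, if both do, whether a trace is `1`, `0` or neither
(`mem_part_iff`). So `h₆` is the sum of `wt B` times `E` applied to the unit vector at `x + B`.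
Expanding `E` in characters, `h₆ z = |X|⁻¹ ∑ g(C) chi ψ C (z - x)` over the `C` of rank one, where
`g` is `dualWeight` (`h_apply_eq_sum_chi`).

Three properties of `g` carry everything. It is constant on nonzero multiples of `C`; it sums to
zero over the `s tᵀ` with `s` fixed, or with `t` fixed; and it vanishes unless `s ⬝ a t = 0`
(`dualWeight_eq_zero`). The last two rest on cancellations among the weights (`sum_wt_right`,
`sum_wt_left`, `sum_wt_perp`).

On the support of `g` the character is trivial at `a`, so `x` may be replaced by `y` in the
expansion, which gives `h₆ = h'₆` (`h_swap`). It also gives `h₆ x = h₆ y`, and `μ₆` is proportional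
to the difference of these values (`mu_eq_zero`). Finally, the Norton product with the image of `x̂`
replaces `g(C)` by `|X|⁻¹` times the sum of `g` over the rank-one `B` with `C - B` of rank one. By
inclusion–exclusion that sum is `0 + 0 - (q - 1) g(C) - g(C) = -q g(C)`
(`sum_neighbors_dualWeight`). -/

set_option linter.unusedSectionVars false

namespace BilForms

/-! ### Rank of a matrix after subtracting a matrix of rank one. -/

section LinearAlgebra

variable {F : Type*} [Field F] {m n : Type*} [Fintype m] [Fintype n]

/-- The column space of a matrix. -/
def colSp (a : Matrix m n F) : Submodule F (m → F) := LinearMap.range a.mulVecLin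

theorem mem_colSp {a : Matrix m n F} {u : m → F} : u ∈ colSp a ↔ ∃ p, a *ᵥ p = u := Iff.rfl

theorem finrank_colSp (a : Matrix m n F) : Module.finrank F (colSp a) = a.rank := rfl

theorem rank_le_rank_of_colSp_le {a b : Matrix m n F} (h : colSp a ≤ colSp b) :
    a.rank ≤ b.rank := Submodule.finrank_mono h

theorem rank_lt_rank_of_colSp_le {a b : Matrix m n F} (h : colSp a ≤ colSp b) {u : m → F}
    (hu : u ∈ colSp b) (hu' : u ∉ colSp a) : a.rank < b.rank :=
  Submodule.finrank_lt_finrank_of_lt (lt_of_le_of_ne h fun e => hu' (by unfold colSp; rw [e]; exact hu))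

/-- A linear section of `a` over its column space extends to the whole space. Such a `G` selects a
preimage `G u` of each `u` in the column space, which makes the later case distinctions explicit. -/
theorem exists_generalized_inverse (a : Matrix m n F) : ∃ G : Matrix n m F, a * G * a = a := by
  classical
  obtain ⟨s, hs⟩ := a.mulVecLin.rangeRestrict.exists_rightInverse_of_surjective
    (LinearMap.range_rangeRestrict _)
  obtain ⟨g, hg⟩ := s.exists_extend
  refine ⟨LinearMap.toMatrix' g, ?_⟩
  apply (toLin' (R := F)).injective
  ext1 j
  refine LinearMap.ext fun c => ?_
  simp only [LinearMap.comp_apply, toLin'_apply, ← mulVec_mulVec, LinearMap.toMatrix'_mulVec]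
  set w := (LinearMap.single F (fun _ : n => F) j) c
  have h1 := LinearMap.congr_fun hg (a.mulVecLin.rangeRestrict w)
  have h2 := congrArg Subtype.val (LinearMap.congr_fun hs (a.mulVecLin.rangeRestrict w))
  change g (a *ᵥ w) = _ at h1
  change a *ᵥ s _ = a *ᵥ w at h2
  rw [h1, h2]

theorem sub_vecMulVec_mulVec (a : Matrix m n F) (u : m → F) (v p : n → F) :
    (a - vecMulVec u v) *ᵥ p = a *ᵥ p - (v ⬝ᵥ p) • u := by
  rw [sub_mulVec, vecMulVec_mulVec]
  simp

theorem colSp_sub_vecMulVec_le {a : Matrix m n F} {u : m → F} (v : n → F) (hu : u ∈ colSp a) :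
    colSp (a - vecMulVec u v) ≤ colSp a := by
  rintro w ⟨p, rfl⟩
  rw [mulVecLin_apply, sub_vecMulVec_mulVec]
  exact Submodule.sub_mem _ ⟨p, rfl⟩ (Submodule.smul_mem _ _ hu)

theorem colSp_le_colSp_sub_vecMulVec {a : Matrix m n F} {u : m → F} {v p₀ : n → F}
    (hp : a *ᵥ p₀ = u) (hv : v ⬝ᵥ p₀ ≠ 1) : colSp a ≤ colSp (a - vecMulVec u v) := by
  rintro w ⟨p, rfl⟩
  have h : 1 - v ⬝ᵥ p₀ ≠ 0 := sub_ne_zero.2 hv.symm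
  -- The coefficient `c` of `p₀` solves `c (1 - v ⬝ p₀) = v ⬝ p`, which cancels the multiple of `u`.
  refine ⟨p + ((v ⬝ᵥ p) / (1 - v ⬝ᵥ p₀)) • p₀, ?_⟩
  rw [mulVecLin_apply, sub_vecMulVec_mulVec, mulVec_add, mulVec_smul, hp, mulVecLin_apply,
    add_sub_assoc, ← sub_smul]
  convert add_zero _
  convert zero_smul F u
  rw [dotProduct_add, dotProduct_smul, smul_eq_mul]
  field_simp
  ring

theorem rank_sub_vecMulVec_of_mem {a : Matrix m n F} {u : m → F} {v p₀ : n → F}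
    (hp : a *ᵥ p₀ = u) (hv : v ⬝ᵥ p₀ ≠ 1) : (a - vecMulVec u v).rank = a.rank :=
  le_antisymm (rank_le_rank_of_colSp_le (colSp_sub_vecMulVec_le v ⟨p₀, hp⟩))
    (rank_le_rank_of_colSp_le (colSp_le_colSp_sub_vecMulVec hp hv))

theorem rank_add_le (a b : Matrix m n F) : (a + b).rank ≤ a.rank + b.rank := by
  refine le_trans (Submodule.finrank_mono (?_ : colSp (a + b) ≤ colSp a ⊔ colSp b))
    (Submodule.finrank_add_le_finrank_add_finrank _ _)
  rintro w ⟨p, rfl⟩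
  rw [mulVecLin_apply, add_mulVec]
  exact Submodule.add_mem_sup ⟨p, rfl⟩ ⟨p, rfl⟩

theorem rank_le_rank_sub_vecMulVec_add_one (a : Matrix m n F) (u : m → F) (v : n → F) :
    a.rank ≤ (a - vecMulVec u v).rank + 1 := by
  calc a.rank = ((a - vecMulVec u v) + vecMulVec u v).rank := by rw [sub_add_cancel]
    _ ≤ _ := (rank_add_le _ _).trans (Nat.add_le_add_left (rank_vecMulVec_le u v) _)

theorem rank_sub_vecMulVec_le (a : Matrix m n F) (u : m → F) (v : n → F) :
    (a - vecMulVec u v).rank ≤ a.rank + 1 := by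
  rw [sub_eq_add_neg, ← neg_vecMulVec]
  exact (rank_add_le _ _).trans (Nat.add_le_add_left (rank_vecMulVec_le _ v) _)

variable {a : Matrix m n F} {G : Matrix n m F}

theorem mem_colSp_iff (hG : a * G * a = a) {u : m → F} : u ∈ colSp a ↔ a *ᵥ (G *ᵥ u) = u := by
  refine ⟨?_, fun h => ⟨_, h⟩⟩
  rintro ⟨p, rfl⟩
  rw [mulVecLin_apply, mulVec_mulVec, mulVec_mulVec, hG]

theorem transpose_generalized_inverse (hG : a * G * a = a) : aᵀ * Gᵀ * aᵀ = aᵀ := by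
  rw [← transpose_mul, ← transpose_mul, ← Matrix.mul_assoc, hG]

/-- Writing `v = aᵀ r` moves `a` next to `G`, where `a G a = a` applies. Thus `v ⬝ G u` is the value
of `v` on any preimage of `u`. -/
theorem dotProduct_mulVec_mulVec_of_mem (hG : a * G * a = a) {v : n → F} (hv : v ∈ colSp aᵀ)
    (t : n → F) : v ⬝ᵥ (G *ᵥ (a *ᵥ t)) = v ⬝ᵥ t := by
  obtain ⟨r, rfl⟩ := hv
  rw [mulVecLin_apply, mulVec_transpose, ← dotProduct_mulVec, ← dotProduct_mulVec, mulVec_mulVec,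
    mulVec_mulVec, hG]

/-- The row space is the full annihilator of the kernel: the columns of `1 - G a` lie in the kernel,
so a `v` killing the kernel satisfies `v = (G a)ᵀ v`. -/
theorem exists_dotProduct_ne_zero (hG : a * G * a = a) {v : n → F} (hv : v ∉ colSp aᵀ) :
    ∃ t, a *ᵥ t = 0 ∧ v ⬝ᵥ t ≠ 0 := by
  classical
  by_contra! h
  refine hv ((mem_colSp_iff (transpose_generalized_inverse hG)).2 ?_)
  rw [mulVec_transpose, mulVec_transpose, vecMul_vecMul]
  funext j
  have := h (Pi.single j 1 - (G * a) *ᵥ Pi.single j 1) (by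
    rw [mulVec_sub, mulVec_mulVec, ← Matrix.mul_assoc, hG, sub_self])
  rw [dotProduct_sub, sub_eq_zero, dotProduct_mulVec] at this
  simpa using this.symm

/-- A preimage of `u` can be shifted by a kernel vector on which `v` is nonzero, so the exceptional
value `1` can always be avoided. -/
theorem rank_sub_vecMulVec_of_notMem_right (hG : a * G * a = a) {u : m → F} {v : n → F}
    (hu : u ∈ colSp a) (hv : v ∉ colSp aᵀ) : (a - vecMulVec u v).rank = a.rank := by
  obtain ⟨t, ht, hvt⟩ := exists_dotProduct_ne_zero hG hv
  obtain ⟨p, hp⟩ := mem_colSp.1 hu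
  by_cases h : v ⬝ᵥ p = 1
  · refine rank_sub_vecMulVec_of_mem (p₀ := p + t) (by rw [mulVec_add, hp, ht, add_zero]) ?_
    rw [dotProduct_add, h]
    simpa using hvt
  · exact rank_sub_vecMulVec_of_mem hp h

theorem rank_sub_vecMulVec_of_notMem_left (hG : a * G * a = a) {u : m → F} {v : n → F}
    (hu : u ∉ colSp a) (hv : v ∈ colSp aᵀ) : (a - vecMulVec u v).rank = a.rank := by
  rw [← rank_transpose, ← rank_transpose a, transpose_sub, transpose_vecMulVec]
  exact rank_sub_vecMulVec_of_notMem_right (transpose_generalized_inverse hG) hv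
    (by rwa [transpose_transpose])

/-- Evaluating at a kernel vector `t` of `a` with `v ⬝ t ≠ 0` puts `u` into the new column space,
which then contains the old one and the extra vector `u`. -/
theorem rank_sub_vecMulVec_of_notMem (hG : a * G * a = a) {u : m → F} {v : n → F}
    (hu : u ∉ colSp a) (hv : v ∉ colSp aᵀ) : (a - vecMulVec u v).rank = a.rank + 1 := by
  obtain ⟨t, ht, hvt⟩ := exists_dotProduct_ne_zero hG hv
  refine le_antisymm (rank_sub_vecMulVec_le _ _ _) ?_
  have hmem : u ∈ colSp (a - vecMulVec u v) := by
    refine ⟨(-(v ⬝ᵥ t)⁻¹) • t, ?_⟩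
    rw [mulVecLin_apply, sub_vecMulVec_mulVec, mulVec_smul, ht, dotProduct_smul, smul_eq_mul,
      neg_mul, inv_mul_cancel₀ hvt]
    simp
  refine rank_lt_rank_of_colSp_le ?_ hmem hu
  rintro w ⟨p, rfl⟩
  have : a *ᵥ p = (a - vecMulVec u v) *ᵥ p + (v ⬝ᵥ p) • u := by
    rw [sub_vecMulVec_mulVec, sub_add_cancel]
  rw [mulVecLin_apply, this]
  exact Submodule.add_mem _ ⟨p, rfl⟩ (Submodule.smul_mem _ _ hmem)

/-- The new column space misses `u`: applying `v ⬝ G` to `a p = u + (v ⬝ p) u` would give `v ⬝ p = 1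
+ v ⬝ p`. -/
theorem rank_sub_vecMulVec_of_eq_one (hG : a * G * a = a) {u : m → F} {v : n → F}
    (hu : u ∈ colSp a) (hv : v ∈ colSp aᵀ) (h : v ⬝ᵥ (G *ᵥ u) = 1) :
    (a - vecMulVec u v).rank + 1 = a.rank := by
  refine le_antisymm ?_ (rank_le_rank_sub_vecMulVec_add_one _ _ _)
  refine rank_lt_rank_of_colSp_le (colSp_sub_vecMulVec_le v hu) hu ?_
  rintro ⟨p, hp⟩
  rw [mulVecLin_apply, sub_vecMulVec_mulVec, sub_eq_iff_eq_add] at hp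
  have := dotProduct_mulVec_mulVec_of_mem hG hv p
  rw [hp, mulVec_add, mulVec_smul, dotProduct_add, dotProduct_smul, h] at this
  simp at this

theorem rank_eq_zero_iff {a : Matrix m n F} : a.rank = 0 ↔ a = 0 := by
  classical
  refine ⟨fun h => ?_, fun h => h ▸ rank_zero⟩
  rw [← finrank_colSp, Submodule.finrank_eq_zero, colSp, LinearMap.range_eq_bot] at h
  ext i j
  simpa using congrFun (LinearMap.congr_fun h (Pi.single j 1)) i

theorem rank_vecMulVec_eq_one {u : m → F} {v : n → F} (hu : u ≠ 0) (hv : v ≠ 0) :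
    (vecMulVec u v).rank = 1 := by
  refine le_antisymm (rank_vecMulVec_le u v) (Nat.one_le_iff_ne_zero.2 fun h => ?_)
  rw [rank_eq_zero_iff] at h
  obtain ⟨i, hi⟩ := Function.ne_iff.1 hu
  obtain ⟨j, hj⟩ := Function.ne_iff.1 hv
  have := congrFun (congrFun h i) j
  rw [vecMulVec_apply] at this
  exact (mul_ne_zero hi hj) this

theorem rank_eq_one_iff {B : Matrix m n F} :
    B.rank = 1 ↔ ∃ u v, u ≠ 0 ∧ v ≠ 0 ∧ B = vecMulVec u v := by
  classical
  refine ⟨fun h => ?_, ?_⟩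
  · obtain ⟨⟨u, hu⟩, hu0, hspan⟩ := finrank_eq_one_iff'.1 ((finrank_colSp B).trans h)
    choose c hc using fun j : n => hspan ⟨B *ᵥ Pi.single j 1, _, rfl⟩
    have hB : B = vecMulVec u c := by
      ext i j
      have := congrFun (congrArg Subtype.val (hc j)) i
      simp only [SetLike.mk_smul_mk, Pi.smul_apply, smul_eq_mul, mulVec_single_one] at this
      rw [vecMulVec_apply, mul_comm, this]
      rfl
    refine ⟨u, c, fun e => hu0 (Subtype.ext e), ?_, hB⟩
    rintro rfl
    have : vecMulVec u 0 = (0 : Matrix m n F) := by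
      ext; simp [vecMulVec_apply]
    rw [hB, this, rank_zero] at h
    exact zero_ne_one h
  · rintro ⟨u, v, hu, hv, rfl⟩
    exact rank_vecMulVec_eq_one hu hv

theorem rank_neg' (a : Matrix m n F) : (-a).rank = a.rank := by
  have e : -a = (-1 : F) • a := by simp
  rw [e, rank_smul_of_mem_nonZeroDivisors _ (by simp)]

theorem rank_sub_comm (a b : Matrix m n F) : (a - b).rank = (b - a).rank := by
  rw [← rank_neg', neg_sub]

theorem rank_smul' {c : F} (hc : c ≠ 0) (a : Matrix m n F) : (c • a).rank = a.rank :=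
  rank_smul_of_mem_nonZeroDivisors _ (by simpa using hc)

theorem vecMulVec_right_injective {u : m → F} (hu : u ≠ 0) :
    Function.Injective fun v : n → F => vecMulVec u v := by
  intro v w h
  obtain ⟨i, hi⟩ := Function.ne_iff.1 hu
  funext j
  exact mul_left_cancel₀ hi (congrFun (congrFun h i) j)

theorem vecMulVec_left_injective {v : n → F} (hv : v ≠ 0) :
    Function.Injective fun u : m → F => vecMulVec u v := by
  intro u w h
  obtain ⟨j, hj⟩ := Function.ne_iff.1 hv
  funext i
  exact mul_right_cancel₀ hj (congrFun (congrFun h i) j)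

/-- A matrix `b` of positive rank can be lowered in rank by subtracting a matrix of rank one. -/
theorem exists_rank_sub_add_one {b : Matrix m n F} (hb : b ≠ 0) :
    ∃ B : Matrix m n F, B.rank = 1 ∧ (b - B).rank + 1 = b.rank := by
  classical
  obtain ⟨G, hG⟩ := exists_generalized_inverse b
  have : ∃ i j, b i j ≠ 0 := by
    by_contra! h
    exact hb (by ext i j; exact h i j)
  obtain ⟨i, j, hij⟩ := this
  -- Column `j` and row `i` of `b`, the row divided by the nonzero entry `b i j` so that the
  -- critical value is `1`.
  have hu : b *ᵥ Pi.single j 1 ∈ colSp b := ⟨_, rfl⟩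
  have hv : bᵀ *ᵥ Pi.single i (b i j)⁻¹ ∈ colSp bᵀ := ⟨_, rfl⟩
  have h1 : (bᵀ *ᵥ Pi.single i (b i j)⁻¹) ⬝ᵥ (G *ᵥ (b *ᵥ Pi.single j 1)) = 1 := by
    rw [dotProduct_mulVec_mulVec_of_mem hG hv]
    simp [hij]
  refine ⟨vecMulVec _ _, rank_vecMulVec_eq_one ?_ ?_, rank_sub_vecMulVec_of_eq_one hG hu hv h1⟩
  · intro h
    rw [h] at h1
    simp at h1
  · intro h
    rw [h] at h1
    simp at h1

end LinearAlgebra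

/-! ### Sums over matrices of rank one and over their common neighbours with zero. -/

section Counting

open scoped Classical
open Finset

variable {F : Type*} [Field F] [Fintype F]

/-- A linear functional that is nonzero on a subspace takes every value on it equally often. -/
theorem card_mem_and_eq_mul_card {V : Type*} [AddCommGroup V] [Module F V] [Fintype V]
    (K : Submodule F V) (f : V →ₗ[F] F) {x₀ : V} (hx₀ : x₀ ∈ K) (hf : f x₀ ≠ 0) (c : F) :
    #{v : V | v ∈ K ∧ f v = c} * Fintype.card F = #{v : V | v ∈ K} := by
  rw [← card_univ, ← card_product]
  -- Translation along `x₀` moves the fibre over `c` onto the fibre over `c + d`.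
  refine card_nbij' (fun p => p.1 + (p.2 / f x₀) • x₀)
    (fun v => (v - ((f v - c) / f x₀) • x₀, f v - c)) ?_ ?_ ?_ ?_
  · rintro ⟨v, d⟩ h
    simp only [coe_product, Set.mem_prod, mem_coe, mem_filter, mem_univ, true_and, and_true] at h
    simpa using K.add_mem h.1 (K.smul_mem _ hx₀)
  · intro v h
    simp only [mem_coe, mem_filter, mem_univ, true_and] at h
    simp only [coe_product, Set.mem_prod, mem_coe, mem_filter, mem_univ, true_and, and_true]
    refine ⟨K.sub_mem h (K.smul_mem _ hx₀), ?_⟩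
    rw [map_sub, map_smul, smul_eq_mul, div_mul_cancel₀ _ hf]
    ring
  · rintro ⟨v, d⟩ h
    simp only [coe_product, Set.mem_prod, mem_coe, mem_filter, mem_univ, true_and, and_true] at h
    have e : f (v + (d / f x₀) • x₀) - c = d := by
      rw [map_add, map_smul, smul_eq_mul, div_mul_cancel₀ _ hf, h.2]
      ring
    simp only [e, add_sub_cancel_right]
  · intro v h
    simp

variable {m n : Type*} [Fintype m] [Fintype n] [DecidableEq m] [DecidableEq n]

theorem card_mem_colSp (a : Matrix m n F) :
    #{u : m → F | u ∈ colSp a} = Fintype.card F ^ a.rank := by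
  rw [← finrank_colSp, ← Module.card_eq_pow_finrank, Fintype.card_subtype]

theorem exists_smul_of_vecMulVec_eq {u u₀ : m → F} {v v₀ : n → F} (hu : u₀ ≠ 0) (hv : v₀ ≠ 0)
    (h : vecMulVec u v = vecMulVec u₀ v₀) : ∃ c : F, c ≠ 0 ∧ u = c • u₀ ∧ v = c⁻¹ • v₀ := by
  obtain ⟨i, hi⟩ := Function.ne_iff.1 hu
  obtain ⟨j, hj⟩ := Function.ne_iff.1 hv
  have e : ∀ i j, u i * v j = u₀ i * v₀ j := fun i j => congrFun (congrFun h i) j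
  simp only [Pi.zero_apply] at hi hj
  have h0 : u i ≠ 0 ∧ v j ≠ 0 := by
    rw [← mul_ne_zero_iff, e]
    exact mul_ne_zero hi hj
  have hc : u i / u₀ i = v₀ j / v j := by
    rw [div_eq_div_iff hi h0.2, e, mul_comm]
  refine ⟨u i / u₀ i, div_ne_zero h0.1 hi, ?_, ?_⟩
  · funext i'
    rw [hc, Pi.smul_apply, smul_eq_mul, div_mul_eq_mul_div, eq_div_iff h0.2, e, mul_comm]
  · funext j'
    rw [Pi.smul_apply, smul_eq_mul, inv_div, div_mul_eq_mul_div, eq_div_iff h0.1, mul_comm, e]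

/-- The factors are unique up to `(c u, c⁻¹ v)`; this is the factor `q - 1` in `sum_rank_one`. -/
theorem card_vecMulVec_eq {B : Matrix m n F} (hB : B.rank = 1) :
    #{p : (m → F) × (n → F) | (p.1 ≠ 0 ∧ p.2 ≠ 0) ∧ vecMulVec p.1 p.2 = B} =
      #{c : F | c ≠ 0} := by
  obtain ⟨u, v, hu, hv, rfl⟩ := rank_eq_one_iff.1 hB
  symm
  refine card_bij (fun c _ => (c • u, c⁻¹ • v)) ?_ ?_ ?_
  · intro c hc
    simp only [mem_filter, mem_univ, true_and] at hc ⊢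
    refine ⟨⟨smul_ne_zero hc hu, smul_ne_zero (inv_ne_zero hc) hv⟩, ?_⟩
    rw [smul_vecMulVec, vecMulVec_smul, smul_smul, mul_inv_cancel₀ hc, one_smul]
  · intro c hc d hd h
    exact smul_left_injective F hu (Prod.ext_iff.1 h).1
  · rintro ⟨u', v'⟩ h
    simp only [mem_filter, mem_univ, true_and] at h
    obtain ⟨c, hc, h1, h2⟩ := exists_smul_of_vecMulVec_eq hu hv h.2
    exact ⟨c, by simpa using hc, by rw [h1, h2]⟩

theorem card_ne_zero : #{c : F | c ≠ 0} = Fintype.card F - 1 := by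
  rw [filter_ne' univ (0 : F), card_erase_of_mem (mem_univ _), card_univ]

theorem cast_card_ne_zero (R : Type*) [AddGroupWithOne R] :
    ((#{c : F | c ≠ 0} : ℕ) : R) = (Fintype.card F : R) - 1 := by
  rw [card_ne_zero, Nat.cast_sub Fintype.card_pos, Nat.cast_one]

theorem sum_ne_zero {V M : Type*} [AddCommGroup V] [Fintype V] [DecidableEq V] [AddCommGroup M] (f : V → M) :
    ∑ v with v ≠ 0, f v = ∑ v, f v - f 0 := by
  rw [filter_ne' univ (0 : V), sum_erase_eq_sub (mem_univ _)]

/-- Sums over matrices of rank one as sums over pairs of nonzero vectors. -/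
theorem sum_rank_one {R : Type*} [Ring R] (f : Matrix m n F → R) :
    ((Fintype.card F : R) - 1) * ∑ B with B.rank = 1, f B =
      ∑ u with u ≠ 0, ∑ v with v ≠ 0, f (vecMulVec u v) := by
  rw [← sum_product', ← filter_product, univ_product_univ, mul_sum]
  rw [← sum_fiberwise_of_maps_to (t := ({B | B.rank = 1} : Finset (Matrix m n F)))
    (g := fun p : (m → F) × (n → F) => vecMulVec p.1 p.2)]
  · refine sum_congr rfl fun B hB => ?_
    simp only [mem_filter, mem_univ, true_and] at hB
    rw [filter_filter, sum_congr rfl (g := fun _ => f B), sum_const, card_vecMulVec_eq hB,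
      nsmul_eq_mul, cast_card_ne_zero]
    intro p hp
    rw [(mem_filter.1 hp).2.2]
  · intro p hp
    simp only [mem_filter, mem_univ, true_and] at hp ⊢
    exact rank_vecMulVec_eq_one hp.1 hp.2

theorem mem_colSp_vecMulVec {u w : m → F} {v : n → F} (h : w ∈ colSp (vecMulVec u v)) :
    ∃ c : F, w = c • u := by
  obtain ⟨p, rfl⟩ := h
  refine ⟨v ⬝ᵥ p, ?_⟩
  rw [mulVecLin_apply, vecMulVec_mulVec]
  simp

/-- Two matrices of rank one are at distance one exactly when they are distinct and share, up to
a scalar, one of the factors. -/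
theorem filter_rank_one_eq {u : m → F} {v : n → F} (hu : u ≠ 0) (hv : v ≠ 0) :
    ({B | B.rank = 1 ∧ (vecMulVec u v - B).rank = 1} : Finset (Matrix m n F)) =
      ((({w | w ≠ 0} : Finset (n → F)).image fun w => vecMulVec u w) ∪
        (({w | w ≠ 0} : Finset (m → F)).image fun w => vecMulVec w v)).erase (vecMulVec u v) := by
  ext B
  simp only [mem_filter, mem_univ, true_and, mem_erase, mem_union, mem_image]
  constructor
  · rintro ⟨h1, h2⟩
    refine ⟨fun e => ?_, ?_⟩
    · rw [e, sub_self, rank_zero] at h2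
      exact zero_ne_one h2
    obtain ⟨G, hG⟩ := exists_generalized_inverse (vecMulVec u v)
    obtain ⟨u', v', hu', hv', rfl⟩ := rank_eq_one_iff.1 h1
    by_cases hu1 : u' ∈ colSp (vecMulVec u v)
    · obtain ⟨c, rfl⟩ := mem_colSp_vecMulVec hu1
      have hc : c ≠ 0 := by rintro rfl; simp at hu'
      exact Or.inl ⟨c • v', smul_ne_zero hc hv', by rw [vecMulVec_smul, smul_vecMulVec]⟩
    · by_cases hv1 : v' ∈ colSp (vecMulVec u v)ᵀ
      · rw [transpose_vecMulVec] at hv1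
        obtain ⟨c, rfl⟩ := mem_colSp_vecMulVec hv1
        have hc : c ≠ 0 := by rintro rfl; simp at hv'
        exact Or.inr ⟨c • u', smul_ne_zero hc hu', by rw [vecMulVec_smul, smul_vecMulVec]⟩
      -- With neither factor shared, the difference would have rank two.
      · rw [rank_sub_vecMulVec_of_notMem hG hu1 hv1, rank_vecMulVec_eq_one hu hv] at h2
        omega
  · rintro ⟨h1, ⟨w, hw, rfl⟩ | ⟨w, hw, rfl⟩⟩
    · refine ⟨rank_vecMulVec_eq_one hu hw, ?_⟩
      rw [← vecMulVec_sub]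
      exact rank_vecMulVec_eq_one hu (sub_ne_zero.2 fun e => h1 (by rw [e]))
    · refine ⟨rank_vecMulVec_eq_one hw hv, ?_⟩
      rw [← sub_vecMulVec]
      exact rank_vecMulVec_eq_one (sub_ne_zero.2 fun e => h1 (by rw [e])) hv

/-- The overlap of the two families of neighbours, needed for inclusion–exclusion in
`sum_neighbors`. -/
theorem image_inter_image_eq {u : m → F} {v : n → F} (hu : u ≠ 0) (hv : v ≠ 0) :
    ((({w | w ≠ 0} : Finset (n → F)).image fun w => vecMulVec u w) ∩
        (({w | w ≠ 0} : Finset (m → F)).image fun w => vecMulVec w v)) =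
      ({c | c ≠ 0} : Finset F).image fun c => c • vecMulVec u v := by
  ext B
  simp only [mem_filter, mem_univ, true_and, mem_inter, mem_image]
  constructor
  · rintro ⟨⟨w, hw, rfl⟩, ⟨w', hw', h⟩⟩
    obtain ⟨c, hc, h1, h2⟩ := exists_smul_of_vecMulVec_eq hu hw h
    refine ⟨c, hc, ?_⟩
    rw [← h, h1, smul_vecMulVec]
  · rintro ⟨c, hc, rfl⟩
    exact ⟨⟨c • v, smul_ne_zero hc hv, by rw [vecMulVec_smul]⟩,
      ⟨c • u, smul_ne_zero hc hu, by rw [smul_vecMulVec]⟩⟩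

/-- Sums over the common neighbours of `0` and a matrix of rank one. -/
theorem sum_neighbors {M : Type*} [AddCommGroup M] (f : Matrix m n F → M) {u : m → F} {v : n → F}
    (hu : u ≠ 0) (hv : v ≠ 0) :
    ∑ B with B.rank = 1 ∧ (vecMulVec u v - B).rank = 1, f B =
      ∑ w with w ≠ 0, f (vecMulVec u w) + ∑ w with w ≠ 0, f (vecMulVec w v) -
        ∑ c : F with c ≠ 0, f (c • vecMulVec u v) - f (vecMulVec u v) := by
  have h0 : vecMulVec u v ≠ 0 := fun h => by
    have := rank_vecMulVec_eq_one hu hv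
    rw [h, rank_zero] at this
    exact zero_ne_one this
  have key := sum_union_inter (f := f)
    (s₁ := (({w | w ≠ 0} : Finset (n → F)).image fun w => vecMulVec u w))
    (s₂ := (({w | w ≠ 0} : Finset (m → F)).image fun w => vecMulVec w v))
  rw [image_inter_image_eq hu hv, sum_image (vecMulVec_right_injective hu).injOn,
    sum_image (vecMulVec_left_injective hv).injOn, sum_image (smul_left_injective F h0).injOn]
    at key
  rw [filter_rank_one_eq hu hv, sum_erase_eq_sub, ← key, add_sub_cancel_right]
  rw [mem_union, mem_image]
  exact Or.inl ⟨v, by simpa using hv, rfl⟩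

end Counting

/-! ### Path-length distance as rank. -/

section Distance

variable {F : Type*} [Field F] [Fintype F] {D N : ℕ}

theorem rank_sub_le_length {x y : Vertex F D N} (p : (graph F D N).Walk x y) :
    (x - y).rank ≤ p.length := by
  induction p with
  | nil => simp
  | @cons u v w h p ih =>
    have h1 : (u - v).rank = 1 := h
    rw [← sub_add_sub_cancel u v w, SimpleGraph.Walk.length_cons]
    have := rank_add_le (u - v) (v - w)
    omega

theorem exists_walk_length_eq_rank (r : ℕ) : ∀ x y : Vertex F D N, (x - y).rank = r →
    ∃ p : (graph F D N).Walk x y, p.length = r := by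
  induction r with
  | zero =>
    intro x y h
    rw [rank_eq_zero_iff, sub_eq_zero] at h
    subst h
    exact ⟨.nil, rfl⟩
  | succ r ih =>
    intro x y h
    obtain ⟨B, hB, hB'⟩ := exists_rank_sub_add_one (b := x - y) (by
      intro e; rw [e, rank_zero] at h; omega)
    obtain ⟨p, hp⟩ := ih (x - B) y (by rw [sub_right_comm]; omega)
    have hadj : (graph F D N).Adj x (x - B) := by
      change (x - (x - B)).rank = 1
      rwa [sub_sub_cancel]
    exact ⟨.cons hadj p, by rw [SimpleGraph.Walk.length_cons, hp]⟩

/-- The path-length distance is the rank of the difference. -/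
theorem dist_eq_rank (x y : Vertex F D N) : dist F D N x y = (x - y).rank := by
  obtain ⟨p, hp⟩ := exists_walk_length_eq_rank _ x y rfl
  refine le_antisymm ((SimpleGraph.dist_le p).trans hp.le) ?_
  obtain ⟨p', hp'⟩ := SimpleGraph.Reachable.exists_walk_length_eq_dist ⟨p⟩
  rw [dist, ← hp']
  exact rank_sub_le_length p'

theorem dist_comm (x y : Vertex F D N) : dist F D N x y = dist F D N y x :=
  SimpleGraph.dist_comm

theorem mem_sphere {i : ℕ} {x z : Vertex F D N} : z ∈ sphere D N i x ↔ (x - z).rank = i := by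
  rw [sphere, Finset.mem_filter, dist_eq_rank]
  simp

end Distance

/-! ### The six positions of a rank-one matrix relative to a fixed matrix. -/

section Classification

open scoped Classical
open Finset

variable {F : Type*} [Field F] {m n : Type*} [Fintype m] [Fintype n]

/-- The position of a matrix `B` of rank one relative to a matrix `a` with generalized inverse
`G`: it depends on whether the column space and the row space of `B` lie in those of `a`, and if
both do, on the trace of `G * B`. -/
noncomputable def cls (a : Matrix m n F) (G : Matrix n m F) (B : Matrix m n F) : Fin 6 :=
  if a * G * B = B then
    if B * G * a = B then
      if (G * B).trace = 1 then 0 else if (G * B).trace = 0 then 1 else 2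
    else 3
  else if B * G * a = B then 4 else 5

variable {a : Matrix m n F} {G : Matrix n m F}

theorem mul_vecMulVec_eq_iff (hG : a * G * a = a) {u : m → F} {v : n → F} (hv : v ≠ 0) :
    a * G * vecMulVec u v = vecMulVec u v ↔ u ∈ colSp a := by
  rw [mem_colSp_iff hG, mul_vecMulVec, mulVec_mulVec]
  exact (vecMulVec_left_injective hv).eq_iff

theorem vecMulVec_mul_eq_iff (hG : a * G * a = a) {u : m → F} {v : n → F} (hu : u ≠ 0) :
    vecMulVec u v * G * a = vecMulVec u v ↔ v ∈ colSp aᵀ := by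
  rw [mem_colSp_iff (transpose_generalized_inverse hG), vecMulVec_mul, vecMulVec_mul,
    mulVec_transpose, mulVec_transpose]
  exact (vecMulVec_right_injective hu).eq_iff

theorem trace_mul_vecMulVec (u : m → F) (v : n → F) :
    (G * vecMulVec u v).trace = v ⬝ᵥ (G *ᵥ u) := by
  rw [mul_vecMulVec, trace_vecMulVec, dotProduct_comm]

theorem cls_vecMulVec (hG : a * G * a = a) {u : m → F} {v : n → F} (hu : u ≠ 0) (hv : v ≠ 0) :
    cls a G (vecMulVec u v) =
      if u ∈ colSp a then
        if v ∈ colSp aᵀ then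
          if v ⬝ᵥ (G *ᵥ u) = 1 then 0 else if v ⬝ᵥ (G *ᵥ u) = 0 then 1 else 2
        else 3
      else if v ∈ colSp aᵀ then 4 else 5 := by
  simp only [cls, mul_vecMulVec_eq_iff hG hv, vecMulVec_mul_eq_iff hG hu, trace_mul_vecMulVec]

/-- Transposition exchanges the row and column conditions and keeps the trace, so every statement
about varying `v` yields one about varying `u`. -/
theorem cls_transpose (a B : Matrix m n F) (G : Matrix n m F) :
    cls aᵀ Gᵀ Bᵀ = Equiv.swap 3 4 (cls a G B) := by
  have h1 : aᵀ * Gᵀ * Bᵀ = Bᵀ ↔ B * G * a = B := by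
    rw [← transpose_mul, ← transpose_mul, ← Matrix.mul_assoc, transpose_inj]
  have h2 : Bᵀ * Gᵀ * aᵀ = Bᵀ ↔ a * G * B = B := by
    rw [← transpose_mul, ← transpose_mul, ← Matrix.mul_assoc, transpose_inj]
  have h3 : (Gᵀ * Bᵀ).trace = (G * B).trace := by
    rw [← transpose_mul, trace_transpose, trace_mul_comm]
  simp only [cls, h1, h2, h3]
  split_ifs <;> decide

theorem cls_transpose_eq_zero_iff {a B : Matrix m n F} {G : Matrix n m F} :
    cls aᵀ Gᵀ Bᵀ = 0 ↔ cls a G B = 0 := by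
  rw [cls_transpose]; generalize cls a G B = i; revert i; decide

theorem cls_transpose_eq_five_iff {a B : Matrix m n F} {G : Matrix n m F} :
    cls aᵀ Gᵀ Bᵀ = 5 ↔ cls a G B = 5 := by
  rw [cls_transpose]; generalize cls a G B = i; revert i; decide

/-- This is the rank-one update case analysis: class `0` lowers the distance to `a`, class `5`
raises it, and the middle four preserve it. -/
theorem rank_sub_of_cls (hG : a * G * a = a) {B : Matrix m n F} (hB : B.rank = 1) :
    (cls a G B = 0 ∧ (a - B).rank + 1 = a.rank) ∨ (cls a G B = 5 ∧ (a - B).rank = a.rank + 1) ∨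
      (cls a G B ≠ 0 ∧ cls a G B ≠ 5 ∧ (a - B).rank = a.rank) := by
  obtain ⟨u, v, hu, hv, rfl⟩ := rank_eq_one_iff.1 hB
  rw [cls_vecMulVec hG hu hv]
  by_cases h1 : u ∈ colSp a <;> by_cases h2 : v ∈ colSp aᵀ
  · by_cases h3 : v ⬝ᵥ (G *ᵥ u) = 1
    · left
      simpa [h1, h2, h3] using rank_sub_vecMulVec_of_eq_one hG h1 h2 h3
    · right; right
      refine ⟨?_, ?_, rank_sub_vecMulVec_of_mem ((mem_colSp_iff hG).1 h1) h3⟩ <;>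
      · simp only [h1, h2, h3, if_true, if_false]
        split_ifs <;> decide
  · right; right
    simpa [h1, h2] using rank_sub_vecMulVec_of_notMem_right hG h1 h2
  · right; right
    simpa [h1, h2] using rank_sub_vecMulVec_of_notMem_left hG h1 h2
  · right; left
    simpa [h1, h2] using rank_sub_vecMulVec_of_notMem hG h1 h2

theorem cls_eq_zero_iff (hG : a * G * a = a) {B : Matrix m n F} (hB : B.rank = 1)
    (ha : a.rank ≠ 0) : cls a G B = 0 ↔ (a - B).rank = a.rank - 1 := by
  rcases rank_sub_of_cls hG hB with ⟨h, h'⟩ | ⟨h, h'⟩ | ⟨h1, h2, h'⟩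
  · exact ⟨fun _ => by omega, fun _ => h⟩
  · rw [h]
    exact ⟨fun e => absurd e (by decide), fun _ => by omega⟩
  · exact ⟨fun e => absurd e h1, fun _ => by omega⟩

theorem cls_eq_five_iff (hG : a * G * a = a) {B : Matrix m n F} (hB : B.rank = 1) :
    cls a G B = 5 ↔ (a - B).rank = a.rank + 1 := by
  rcases rank_sub_of_cls hG hB with ⟨h, h'⟩ | ⟨h, h'⟩ | ⟨h1, h2, h'⟩
  · rw [h]
    exact ⟨fun e => absurd e (by decide), fun _ => by omega⟩
  · exact ⟨fun _ => by omega, fun _ => h⟩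
  · exact ⟨fun e => absurd e h2, fun _ => by omega⟩

theorem cls_smul_eq_zero_iff {B : Matrix m n F} {c : F} (hc : c ≠ 0) :
    cls a G (c • B) = 0 ↔ (cls a G B = 0 ∨ cls a G B = 2) ∧ c * (G * B).trace = 1 := by
  have h1 : a * G * (c • B) = c • B ↔ a * G * B = B := by
    rw [Matrix.mul_smul]; exact (smul_right_injective _ hc).eq_iff
  have h2 : (c • B) * G * a = c • B ↔ B * G * a = B := by
    rw [Matrix.smul_mul, Matrix.smul_mul]; exact (smul_right_injective _ hc).eq_iff
  have h3 : (G * (c • B)).trace = c * (G * B).trace := by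
    rw [Matrix.mul_smul, trace_smul, smul_eq_mul]
  simp only [cls, h1, h2, h3]
  split_ifs <;> simp_all

theorem cls_smul_eq_five_iff {B : Matrix m n F} {c : F} (hc : c ≠ 0) :
    cls a G (c • B) = 5 ↔ cls a G B = 5 := by
  have h1 : a * G * (c • B) = c • B ↔ a * G * B = B := by
    rw [Matrix.mul_smul]; exact (smul_right_injective _ hc).eq_iff
  have h2 : (c • B) * G * a = c • B ↔ B * G * a = B := by
    rw [Matrix.smul_mul, Matrix.smul_mul]; exact (smul_right_injective _ hc).eq_iff
  simp only [cls, h1, h2]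
  split_ifs <;> simp

/-- A function of the class of `B` that does not separate the classes `0` and `2` is invariant
under nonzero scalars. -/
theorem apply_cls_smul {R : Type*} {w : Fin 6 → R} (hw : w 0 = w 2) {B : Matrix m n F} {c : F}
    (hc : c ≠ 0) : w (cls a G (c • B)) = w (cls a G B) := by
  have h1 : a * G * (c • B) = c • B ↔ a * G * B = B := by
    rw [Matrix.mul_smul]; exact (smul_right_injective _ hc).eq_iff
  have h2 : (c • B) * G * a = c • B ↔ B * G * a = B := by
    rw [Matrix.smul_mul, Matrix.smul_mul]; exact (smul_right_injective _ hc).eq_iff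
  have h3 : (G * (c • B)).trace = 0 ↔ (G * B).trace = 0 := by
    rw [Matrix.mul_smul, trace_smul, smul_eq_mul, mul_eq_zero, or_iff_right hc]
  simp only [cls, h1, h2]
  split_ifs <;> simp_all

/-- Only the sign of the trace changes, so class `1` is kept and only classes `0` and `2` can mix.
This is what exchanging `x` and `y` does to the weights. -/
theorem apply_cls_neg {R : Type*} {w : Fin 6 → R} (hw : w 0 = w 2) {B : Matrix m n F} :
    w (cls (-a) (-G) B) = w (cls a G B) := by
  have h1 : -a * -G * B = B ↔ a * G * B = B := by
    rw [Matrix.neg_mul, Matrix.mul_neg, neg_neg]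
  have h2 : B * -G * -a = B ↔ B * G * a = B := by
    rw [Matrix.mul_neg, Matrix.mul_neg, Matrix.neg_mul, neg_neg]
  have h3 : (-G * B).trace = - (G * B).trace := by rw [Matrix.neg_mul, trace_neg]
  have h4 : (- (G * B).trace) = 0 ↔ (G * B).trace = 0 := neg_eq_zero
  simp only [cls, h1, h2, h3]
  split_ifs <;> simp_all

variable [Fintype F] [DecidableEq m] [DecidableEq n]

/-- Row `i` of `a` takes the value `(a G u) i = u i` on `G u`; choose `i` with `u i ≠ 0`. -/
theorem exists_mem_dotProduct_ne_zero (hG : a * G * a = a) {u : m → F} (hu : u ≠ 0)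
    (hua : u ∈ colSp a) : ∃ v ∈ colSp aᵀ, v ⬝ᵥ (G *ᵥ u) ≠ 0 := by
  obtain ⟨i, hi⟩ := Function.ne_iff.1 hu
  refine ⟨aᵀ *ᵥ Pi.single i 1, ⟨_, rfl⟩, ?_⟩
  rw [mulVec_transpose, ← dotProduct_mulVec, (mem_colSp_iff hG).1 hua]
  simpa using hi

/-- The linear functional `v ↦ v ⬝ᵥ p`. -/
def dotFun (p : n → F) : (n → F) →ₗ[F] F where
  toFun v := v ⬝ᵥ p
  map_add' v w := add_dotProduct v w p
  map_smul' c v := smul_dotProduct c v p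

theorem dotFun_apply (p v : n → F) : dotFun p v = v ⬝ᵥ p := rfl

theorem card_row_dotProduct_eq (hG : a * G * a = a) {u : m → F} (hu : u ≠ 0)
    (hua : u ∈ colSp a) (ha : a.rank ≠ 0) (c : F) :
    #{v | v ∈ colSp aᵀ ∧ v ⬝ᵥ (G *ᵥ u) = c} = Fintype.card F ^ (a.rank - 1) := by
  obtain ⟨v₀, hv₀, h⟩ := exists_mem_dotProduct_ne_zero hG hu hua
  have := card_mem_and_eq_mul_card (colSp aᵀ) (dotFun (G *ᵥ u)) hv₀ h c
  rw [card_mem_colSp, rank_transpose, ← pow_sub_one_mul ha] at this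
  exact Nat.eq_of_mul_eq_mul_right Fintype.card_pos this

theorem card_filter_cls_eq_zero (hG : a * G * a = a) {u : m → F} (hu : u ≠ 0) (ha : a.rank ≠ 0) :
    #{v : n → F | v ≠ 0 ∧ cls a G (vecMulVec u v) = 0} =
      if u ∈ colSp a then Fintype.card F ^ (a.rank - 1) else 0 := by
  split_ifs with h
  · rw [← card_row_dotProduct_eq hG hu h ha 1]
    congr 1
    ext v
    simp only [mem_filter, mem_univ, true_and]
    constructor
    · rintro ⟨hv, h'⟩
      rw [cls_vecMulVec hG hu hv] at h'
      split_ifs at h' with h1 h2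
      · exact ⟨h1, h2⟩
      all_goals exact absurd h' (by decide)
    · rintro ⟨h1, h2⟩
      have hv : v ≠ 0 := by rintro rfl; simp at h2
      refine ⟨hv, ?_⟩
      rw [cls_vecMulVec hG hu hv]
      simp [h, h1, h2]
  · rw [card_eq_zero, filter_eq_empty_iff]
    rintro v - ⟨hv, h'⟩
    rw [cls_vecMulVec hG hu hv, if_neg h] at h'
    split_ifs at h' <;> exact absurd h' (by decide)

theorem card_filter_cls_eq_five (hG : a * G * a = a) {u : m → F} (hu : u ≠ 0) :
    ((#{v : n → F | v ≠ 0 ∧ cls a G (vecMulVec u v) = 5} : ℕ) : ℤ) =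
      if u ∈ colSp a then 0 else
        (Fintype.card F : ℤ) ^ Fintype.card n - (Fintype.card F : ℤ) ^ a.rank := by
  split_ifs with h
  · rw [Nat.cast_eq_zero, card_eq_zero, filter_eq_empty_iff]
    rintro v - ⟨hv, h'⟩
    rw [cls_vecMulVec hG hu hv, if_pos h] at h'
    split_ifs at h' <;> exact absurd h' (by decide)
  · have e : filter (fun v : n → F => v ≠ 0 ∧ cls a G (vecMulVec u v) = 5) univ =
        filter (fun v => ¬ v ∈ colSp aᵀ) univ := by
      ext v
      simp only [mem_filter, mem_univ, true_and]
      constructor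
      · rintro ⟨hv, h'⟩
        rw [cls_vecMulVec hG hu hv, if_neg h] at h'
        split_ifs at h' with h1
        · exact absurd h' (by decide)
        · exact h1
      · intro h1
        have hv : v ≠ 0 := by rintro rfl; exact h1 (Submodule.zero_mem _)
        exact ⟨hv, by rw [cls_vecMulVec hG hu hv, if_neg h, if_neg h1]⟩
    have := card_filter_add_card_filter_not (s := (univ : Finset (n → F))) (· ∈ colSp aᵀ)
    rw [card_mem_colSp, rank_transpose, card_univ, Fintype.card_fun] at this
    rw [e, eq_sub_iff_add_eq']
    exact_mod_cast this

theorem card_filter_cls_eq_zero_left (hG : a * G * a = a) {v : n → F} (hv : v ≠ 0)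
    (ha : a.rank ≠ 0) : #{u : m → F | u ≠ 0 ∧ cls a G (vecMulVec u v) = 0} =
      if v ∈ colSp aᵀ then Fintype.card F ^ (a.rank - 1) else 0 := by
  have := card_filter_cls_eq_zero (transpose_generalized_inverse hG) hv
    (by rwa [rank_transpose])
  rw [rank_transpose] at this
  rw [← this]
  simp only [← cls_transpose_eq_zero_iff (a := a), transpose_vecMulVec]

theorem card_filter_cls_eq_five_left (hG : a * G * a = a) {v : n → F} (hv : v ≠ 0) :
    ((#{u : m → F | u ≠ 0 ∧ cls a G (vecMulVec u v) = 5} : ℕ) : ℤ) =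
      if v ∈ colSp aᵀ then 0 else
        (Fintype.card F : ℤ) ^ Fintype.card m - (Fintype.card F : ℤ) ^ a.rank := by
  have := card_filter_cls_eq_five (transpose_generalized_inverse hG) hv
  rw [rank_transpose] at this
  rw [← this]
  simp only [← cls_transpose_eq_five_iff (a := a), transpose_vecMulVec]

theorem card_neighbors (a : Matrix m n F) (G : Matrix n m F) {u : m → F} {v : n → F}
    (hu : u ≠ 0) (hv : v ≠ 0) (i : Fin 6) :
    ((#{B : Matrix m n F | (B.rank = 1 ∧ (vecMulVec u v - B).rank = 1) ∧ cls a G B = i} : ℕ) : ℤ) =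
      ((#{w : n → F | w ≠ 0 ∧ cls a G (vecMulVec u w) = i} : ℕ) : ℤ) +
      ((#{w : m → F | w ≠ 0 ∧ cls a G (vecMulVec w v) = i} : ℕ) : ℤ) -
      ((#{c : F | c ≠ 0 ∧ cls a G (c • vecMulVec u v) = i} : ℕ) : ℤ) -
      (if cls a G (vecMulVec u v) = i then 1 else 0) := by
  have := sum_neighbors (fun B => if cls a G B = i then (1 : ℤ) else 0) hu hv
  simpa only [sum_boole, filter_filter] using this

/-- The number of common neighbours one step closer to `a`. -/
theorem card_neighbors_zero (hG : a * G * a = a) (ha : a.rank ≠ 0) {B : Matrix m n F}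
    (hB : B.rank = 1) :
    ((#{C : Matrix m n F | (C.rank = 1 ∧ (B - C).rank = 1) ∧ cls a G C = 0} : ℕ) : ℤ) =
      (![2 * (Fintype.card F : ℤ) ^ (a.rank - 1) - 2, 2 * (Fintype.card F : ℤ) ^ (a.rank - 1),
        2 * (Fintype.card F : ℤ) ^ (a.rank - 1) - 1, (Fintype.card F : ℤ) ^ (a.rank - 1),
        (Fintype.card F : ℤ) ^ (a.rank - 1), 0] : Fin 6 → ℤ) (cls a G B) := by
  -- In classes `0` and `2` the trace is nonzero, and exactly one multiple of `B` has trace `1`.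
  -- Class `0` loses a further `1` because `B` itself is then counted, whence `-2` against `-1`.
  have hc : ((#{c : F | c ≠ 0 ∧ cls a G (c • B) = 0} : ℕ) : ℤ) =
      if cls a G B = 0 ∨ cls a G B = 2 then 1 else 0 := by
    split_ifs with h
    · have ht : (G * B).trace ≠ 0 := by
        unfold cls at h
        split_ifs at h with h1 h2 h3 h4
        · rw [h3]; exact one_ne_zero
        all_goals simp_all
      rw [Nat.cast_eq_one, card_eq_one]
      refine ⟨(G * B).trace⁻¹, ?_⟩
      ext c
      simp only [mem_filter, mem_univ, true_and, mem_singleton]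
      constructor
      · rintro ⟨hc, h'⟩
        exact eq_inv_of_mul_eq_one_left ((cls_smul_eq_zero_iff hc).1 h').2
      · rintro rfl
        exact ⟨inv_ne_zero ht, (cls_smul_eq_zero_iff (inv_ne_zero ht)).2
          ⟨h, inv_mul_cancel₀ ht⟩⟩
    · rw [Nat.cast_eq_zero, card_eq_zero, filter_eq_empty_iff]
      rintro c - ⟨hc, h'⟩
      exact h ((cls_smul_eq_zero_iff hc).1 h').1
  obtain ⟨u, v, hu, hv, rfl⟩ := rank_eq_one_iff.1 hB
  rw [card_neighbors a G hu hv, hc, card_filter_cls_eq_zero hG hu ha,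
    card_filter_cls_eq_zero_left hG hv ha, cls_vecMulVec hG hu hv]
  split_ifs <;> simp_all <;> ring

/-- The number of common neighbours one step further from `a`. -/
theorem card_neighbors_five (hG : a * G * a = a) {B : Matrix m n F} (hB : B.rank = 1) :
    (cls a G B ≠ 5) →
    ((#{C : Matrix m n F | (C.rank = 1 ∧ (B - C).rank = 1) ∧ cls a G C = 5} : ℕ) : ℤ) =
      (![0, 0, 0, (Fintype.card F : ℤ) ^ Fintype.card m - (Fintype.card F : ℤ) ^ a.rank,
        (Fintype.card F : ℤ) ^ Fintype.card n - (Fintype.card F : ℤ) ^ a.rank, 0] : Fin 6 → ℤ)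
        (cls a G B) := by
  intro h
  have hc : ((#{c : F | c ≠ 0 ∧ cls a G (c • B) = 5} : ℕ) : ℤ) = 0 := by
    rw [Nat.cast_eq_zero, card_eq_zero, filter_eq_empty_iff]
    rintro c - ⟨hc, h'⟩
    exact h ((cls_smul_eq_five_iff hc).1 h')
  obtain ⟨u, v, hu, hv, rfl⟩ := rank_eq_one_iff.1 hB
  rw [card_neighbors a G hu hv, hc, card_filter_cls_eq_five hG hu,
    card_filter_cls_eq_five_left hG hv, if_neg h]
  rw [cls_vecMulVec hG hu hv] at h ⊢
  split_ifs at h ⊢ <;> simp_all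

end Classification

/-! ### The combinatorial cells are the algebraic classes. -/

section Partition

open scoped Classical
open Finset

variable {F : Type*} [Field F] [Fintype F] {D N : ℕ}

theorem card_sphere_inter (x y z : Vertex F D N) (j : ℕ) :
    #(sphere D N 1 x ∩ sphere D N 1 z ∩ sphere D N j y) =
      #{C : Vertex F D N | (C.rank = 1 ∧ ((z - x) - C).rank = 1) ∧ ((y - x) - C).rank = j} := by
  refine card_bij (fun w _ => w - x) ?_ ?_ ?_
  · intro w hw
    simp only [mem_inter, mem_sphere] at hw
    simp only [mem_filter, mem_univ, true_and, sub_sub_sub_cancel_right]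
    exact ⟨⟨by rw [rank_sub_comm]; exact hw.1.1, hw.1.2⟩, hw.2⟩
  · intro w _ w' _ h
    exact sub_left_injective h
  · intro C hC
    simp only [mem_filter, mem_univ, true_and] at hC
    refine ⟨x + C, ?_, add_sub_cancel_left x C⟩
    simp only [mem_inter, mem_sphere]
    refine ⟨⟨?_, ?_⟩, ?_⟩
    · rw [rank_sub_comm, add_sub_cancel_left]; exact hC.1.1
    · rw [← sub_sub]; exact hC.1.2
    · rw [← sub_sub]; exact hC.2

theorem card_closer {x y z : Vertex F D N} {G : Matrix (Fin (N - D)) (Fin D) F}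
    (hG : (y - x) * G * (y - x) = y - x) (hk : (y - x).rank ≠ 0) (hz : (z - x).rank = 1) :
    ((#(sphere D N 1 x ∩ sphere D N 1 z ∩ sphere D N ((y - x).rank - 1) y) : ℕ) : ℤ) =
      (![2 * (Fintype.card F : ℤ) ^ ((y - x).rank - 1) - 2,
        2 * (Fintype.card F : ℤ) ^ ((y - x).rank - 1),
        2 * (Fintype.card F : ℤ) ^ ((y - x).rank - 1) - 1,
        (Fintype.card F : ℤ) ^ ((y - x).rank - 1),
        (Fintype.card F : ℤ) ^ ((y - x).rank - 1), 0] : Fin 6 → ℤ) (cls (y - x) G (z - x)) := by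
  refine Eq.trans ?_ (card_neighbors_zero hG hk hz)
  rw [card_sphere_inter, Nat.cast_inj]
  apply congrArg card
  ext C
  simp only [mem_filter, mem_univ, true_and]
  refine and_congr_right fun h => ?_
  rw [cls_eq_zero_iff hG h.1 hk]

theorem card_further {x y z : Vertex F D N} {G : Matrix (Fin (N - D)) (Fin D) F}
    (hG : (y - x) * G * (y - x) = y - x) (hz : (z - x).rank = 1)
    (h5 : cls (y - x) G (z - x) ≠ 5) :
    ((#(sphere D N 1 x ∩ sphere D N 1 z ∩ sphere D N ((y - x).rank + 1) y) : ℕ) : ℤ) =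
      (![0, 0, 0, (Fintype.card F : ℤ) ^ D - (Fintype.card F : ℤ) ^ (y - x).rank,
        (Fintype.card F : ℤ) ^ (N - D) - (Fintype.card F : ℤ) ^ (y - x).rank, 0] : Fin 6 → ℤ)
        (cls (y - x) G (z - x)) := by
  have h := card_neighbors_five hG hz h5
  rw [Fintype.card_fin, Fintype.card_fin] at h
  refine Eq.trans ?_ h
  rw [card_sphere_inter, Nat.cast_inj]
  apply congrArg card
  ext C
  simp only [mem_filter, mem_univ, true_and]
  refine and_congr_right fun h => ?_
  rw [cls_eq_five_iff hG h.1]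

theorem mem_midPart {x y z : Vertex F D N} {a b : ℤ} : z ∈ midPart D N x y a b ↔
    ((x - z).rank = 1 ∧ (y - z).rank = (y - x).rank) ∧
    ((#(sphere D N 1 x ∩ sphere D N 1 z ∩ sphere D N ((y - x).rank - 1) y) : ℕ) : ℤ) = a ∧
    ((#(sphere D N 1 x ∩ sphere D N 1 z ∩ sphere D N ((y - x).rank + 1) y) : ℕ) : ℤ) = b := by
  rw [midPart, dist_eq_rank, rank_sub_comm x y, mem_filter, mem_inter, mem_sphere, mem_sphere]

/-- The cells of the `y`-partition of `Γ(x)` are the classes of the matrices of rank one relative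
to `y - x`. -/
theorem mem_part_iff {x y : Vertex F D N} {G : Matrix (Fin (N - D)) (Fin D) F}
    (hG : (y - x) * G * (y - x) = y - x) (hk : (y - x).rank ≠ 0) (hkD : (y - x).rank < D)
    (hN : D < N - D) (z : Vertex F D N) (i : Fin 6) :
    z ∈ part D N x y i ↔ (z - x).rank = 1 ∧ cls (y - x) G (z - x) = i := by
  have hd : dist F D N x y = (y - x).rank := by rw [dist_eq_rank, rank_sub_comm]
  by_cases hz : (z - x).rank = 1
  swap
  · have hz' : ¬ (x - z).rank = 1 := by rwa [rank_sub_comm]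
    fin_cases i <;> simp [part, mem_midPart, mem_sphere, hz, hz']
  have hz' : (x - z).rank = 1 := by rwa [rank_sub_comm]
  have hyz : (y - z) = (y - x) - (z - x) := by abel
  have c0 := card_closer hG hk hz
  have c5 := card_further hG hz
  have hq : 1 < (Fintype.card F : ℤ) := by exact_mod_cast Fintype.one_lt_card
  -- These inequalities keep the four defining pairs of counts apart: `k < D` makes the second
  -- entries of classes `3` and `4` positive, and `D < N - D` makes them different.
  have p0 : (0 : ℤ) < (Fintype.card F : ℤ) ^ ((y - x).rank - 1) := by positivity
  have p1 : (Fintype.card F : ℤ) ^ (y - x).rank < (Fintype.card F : ℤ) ^ D :=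
    pow_lt_pow_right₀ hq hkD
  have p2 : (Fintype.card F : ℤ) ^ D < (Fintype.card F : ℤ) ^ (N - D) :=
    pow_lt_pow_right₀ hq hN
  rcases rank_sub_of_cls hG hz with ⟨h, h'⟩ | ⟨h, h'⟩ | ⟨h1, h2, h'⟩
  · rw [h]
    have e1 : (y - z).rank = (y - x).rank - 1 := by rw [hyz]; omega
    have e2 : ¬ (y - x).rank - 1 = (y - x).rank := by omega
    have e3 : ¬ (y - x).rank - 1 = (y - x).rank + 1 := by omega
    fin_cases i <;> simp [part, mem_midPart, mem_sphere, hd, hz, hz', e1, e2, e3]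
  · rw [h]
    have e1 : (y - z).rank = (y - x).rank + 1 := by rw [hyz, h']
    have e3 : ¬ (y - x).rank + 1 = (y - x).rank - 1 := by omega
    fin_cases i <;> simp [part, mem_midPart, mem_sphere, hd, hz, hz', e1, e3]
  · have e1 : (y - z).rank = (y - x).rank := by rw [hyz, h']
    have e2 : ¬ (y - x).rank = (y - x).rank - 1 := by omega
    have c5 := c5 h2
    generalize hp :
      ((#(sphere D N 1 x ∩ sphere D N 1 z ∩ sphere D N ((y - x).rank - 1) y) : ℕ) : ℤ) = s at c0
    generalize hr :
      ((#(sphere D N 1 x ∩ sphere D N 1 z ∩ sphere D N ((y - x).rank + 1) y) : ℕ) : ℤ) = r at c5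
    generalize cls (y - x) G (z - x) = j at *
    fin_cases j <;> dsimp at c0 c5 h1 h2
    · exact absurd rfl h1
    all_goals first | exact absurd rfl h2 | skip
    all_goals
      fin_cases i <;>
      simp [part, mem_midPart, mem_sphere, hd, hz, hz', e1, e2, hp, hr, -inter_assoc] <;> omega

end Partition

/-! ### The eigenvalue formula. -/

/-- The eigenvalue `θ_i` (and dual eigenvalue `θ*_i`) of the graph of bilinear forms on
`d × e` matrices. -/
noncomputable def phi (q : ℝ) (d e i : ℕ) : ℝ := (q ^ (d + e) / q ^ i - q ^ d - q ^ e + 1) / (q - 1)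

theorem phi_strictAnti {q : ℝ} (hq : 1 < q) (d e : ℕ) : StrictAnti (phi q d e) := by
  intro i j hij
  unfold phi
  have h0 : 0 < q - 1 := sub_pos.2 hq
  have h1 : q ^ i < q ^ j := pow_lt_pow_right₀ hq hij
  have h2 : 0 < q ^ i := by positivity
  have h3 : q ^ (d + e) / q ^ j < q ^ (d + e) / q ^ i :=
    div_lt_div_of_pos_left (by positivity) h2 h1
  gcongr

/-! ### Additive characters of the group of matrices. -/

section Characters

open scoped Classical
open Finset

variable {F : Type*} [Field F] [Fintype F]

theorem exists_primitive_addChar (F : Type*) [Field F] [Fintype F] :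
    ∃ ψ : AddChar F ℂ, ψ.IsPrimitive := by
  obtain ⟨ψ, hψ⟩ := AddChar.exists_apply_ne_zero.2 (one_ne_zero (α := F))
  exact ⟨ψ, AddChar.IsPrimitive.of_ne_one fun h => hψ (by rw [h, AddChar.one_apply])⟩

theorem exists_apply_mul_ne_one {ψ : AddChar F ℂ} (hψ : ψ.IsPrimitive) {a : F} (ha : a ≠ 0) :
    ∃ c, ψ (c * a) ≠ 1 := by
  by_contra! h
  refine hψ ha ?_
  ext c
  rw [AddChar.mulShift_apply, mul_comm, h, AddChar.one_apply]

/-- Translating the variable by `c • v` multiplies the sum by `ψ (c * f v)`, which can be made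
different from `1` when `f v ≠ 0`. -/
theorem sum_apply_linear {ψ : AddChar F ℂ} (hψ : ψ.IsPrimitive) {V : Type*} [AddCommGroup V]
    [Module F V] [Fintype V] (f : V →ₗ[F] F) :
    ∑ v, ψ (f v) = if f = 0 then (Fintype.card V : ℂ) else 0 := by
  split_ifs with h
  · simp [h]
  · obtain ⟨v, hv⟩ : ∃ v, f v ≠ 0 := by
      by_contra! h'
      exact h (LinearMap.ext h')
    obtain ⟨c, hc⟩ := exists_apply_mul_ne_one hψ hv
    have e : ψ (c * f v) * ∑ w, ψ (f w) = ∑ w, ψ (f w) := by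
      rw [mul_sum, ← Equiv.sum_comp (Equiv.addLeft (c • v)) fun w => ψ (f w)]
      refine sum_congr rfl fun w _ => ?_
      rw [Equiv.coe_addLeft, map_add, map_smul, smul_eq_mul, AddChar.map_add_eq_mul]
    by_contra h0
    exact hc (mul_right_cancel₀ h0 (e.trans (one_mul _).symm))

variable {m n : Type*} [Fintype m] [Fintype n] [DecidableEq m] [DecidableEq n]

theorem dotFun_eq_zero_iff {p : n → F} : dotFun p = 0 ↔ p = 0 := by
  refine ⟨fun h => ?_, fun h => LinearMap.ext fun v => by simp [dotFun_apply, h]⟩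
  funext j
  simpa [dotFun_apply] using LinearMap.congr_fun h (Pi.single j 1)

theorem sum_apply_dotProduct {ψ : AddChar F ℂ} (hψ : ψ.IsPrimitive) (p : n → F) :
    ∑ v : n → F, ψ (v ⬝ᵥ p) = if p = 0 then (Fintype.card F : ℂ) ^ Fintype.card n else 0 := by
  have := sum_apply_linear hψ (dotFun p)
  simp only [dotFun_apply, dotFun_eq_zero_iff, Fintype.card_fun] at this
  rw [this]
  push_cast
  rfl

theorem card_mulVec_eq_zero_mul (z : Matrix m n F) :
    #{t : n → F | z *ᵥ t = 0} * Fintype.card F ^ z.rank = Fintype.card F ^ Fintype.card n := by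
  have h1 : #{t : n → F | z *ᵥ t = 0} =
      Fintype.card F ^ Module.finrank F (LinearMap.ker z.mulVecLin) := by
    rw [← Module.card_eq_pow_finrank, Fintype.card_subtype]
    simp only [LinearMap.mem_ker, mulVecLin_apply]
  rw [h1, ← finrank_colSp, ← pow_add, add_comm, colSp, LinearMap.finrank_range_add_finrank_ker,
    Module.finrank_fintype_fun_eq_card]

/-- The additive character of the group of matrices indexed by `C`. -/
noncomputable def chi (ψ : AddChar F ℂ) (C z : Matrix m n F) : ℂ := ψ (Cᵀ * z).trace

variable (ψ : AddChar F ℂ)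

theorem chi_add_right (C z w : Matrix m n F) : chi ψ C (z + w) = chi ψ C z * chi ψ C w := by
  rw [chi, Matrix.mul_add, trace_add, AddChar.map_add_eq_mul]; rfl

theorem chi_comm (C z : Matrix m n F) : chi ψ C z = chi ψ z C := by
  rw [chi, chi, ← trace_transpose, transpose_mul, transpose_transpose]

theorem chi_add_left (C C' z : Matrix m n F) : chi ψ (C + C') z = chi ψ C z * chi ψ C' z := by
  rw [chi_comm, chi_add_right, chi_comm ψ z, chi_comm ψ z]

theorem chi_zero_left (z : Matrix m n F) : chi ψ 0 z = 1 := by simp [chi]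

theorem chi_zero_right (C : Matrix m n F) : chi ψ C 0 = 1 := by simp [chi]

theorem chi_smul_comm (c : F) (C z : Matrix m n F) : chi ψ (c • C) z = chi ψ C (c • z) := by
  rw [chi, chi, transpose_smul, Matrix.smul_mul, Matrix.mul_smul]

theorem trace_vecMulVec_mul (s : m → F) (t : n → F) (z : Matrix m n F) :
    ((vecMulVec s t)ᵀ * z).trace = s ⬝ᵥ (z *ᵥ t) := by
  rw [transpose_vecMulVec, vecMulVec_mul, trace_vecMulVec, dotProduct_mulVec, dotProduct_comm]

theorem chi_vecMulVec (s : m → F) (t : n → F) (z : Matrix m n F) :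
    chi ψ (vecMulVec s t) z = ψ (s ⬝ᵥ (z *ᵥ t)) := by
  rw [chi, trace_vecMulVec_mul]

variable {ψ}

theorem sum_chi (hψ : ψ.IsPrimitive) (z : Matrix m n F) :
    ∑ C, chi ψ C z = if z = 0 then (Fintype.card (Matrix m n F) : ℂ) else 0 := by
  let f : Matrix m n F →ₗ[F] F :=
    { toFun := fun C => (Cᵀ * z).trace
      map_add' := fun C C' => by rw [transpose_add, Matrix.add_mul, trace_add]
      map_smul' := fun c C => by
        rw [transpose_smul, Matrix.smul_mul, trace_smul, RingHom.id_apply] }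
  have hf : f = 0 ↔ z = 0 := by
    refine ⟨fun h => ?_, fun h => LinearMap.ext fun C => by simp [f, h]⟩
    ext i j
    have := LinearMap.congr_fun h (vecMulVec (Pi.single i 1) (Pi.single j 1))
    refine Eq.trans ?_ ((trace_vecMulVec_mul _ _ _).symm.trans this)
    simp
  have := sum_apply_linear hψ f
  simp only [hf] at this
  exact this

/-- Summing over `u` first detects `z v = 0`; the number of such `v` comes from rank–nullity. -/
theorem sum_sum_apply (hψ : ψ.IsPrimitive) (z : Matrix m n F) :
    ∑ u : m → F, ∑ v : n → F, ψ (u ⬝ᵥ (z *ᵥ v)) =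
      (Fintype.card F : ℂ) ^ (Fintype.card m + Fintype.card n) / (Fintype.card F : ℂ) ^ z.rank := by
  have hq : (Fintype.card F : ℂ) ≠ 0 := Nat.cast_ne_zero.2 Fintype.card_ne_zero
  rw [sum_comm]
  simp only [sum_apply_dotProduct hψ]
  rw [← sum_filter, sum_const, nsmul_eq_mul, eq_div_iff (pow_ne_zero _ hq), pow_add]
  have := congrArg (Nat.cast : ℕ → ℂ) (card_mulVec_eq_zero_mul z)
  push_cast at this
  rw [← this]
  ring

/-- Multiplied by `q - 1`, this is the full double sum with the terms `u = 0` and `v = 0` removed by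
inclusion–exclusion. It produces both the eigenvalues and the dual eigenvalues, which is why one
formula serves for both. -/
theorem sum_rank_one_chi (hψ : ψ.IsPrimitive) (z : Matrix m n F) :
    ∑ C with C.rank = 1, chi ψ C z =
      (phi (Fintype.card F) (Fintype.card m) (Fintype.card n) z.rank : ℂ) := by
  have hq : (Fintype.card F : ℂ) - 1 ≠ 0 := by
    rw [sub_ne_zero]
    exact_mod_cast Fintype.one_lt_card.ne'
  refine mul_left_cancel₀ hq ?_
  rw [sum_rank_one]
  have h1 : ∀ u : m → F, ∑ v : n → F with v ≠ 0, chi ψ (vecMulVec u v) z =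
      ∑ v, ψ (u ⬝ᵥ (z *ᵥ v)) - 1 := by
    intro u
    rw [sum_ne_zero]
    simp [chi_vecMulVec]
  simp only [h1]
  rw [sum_ne_zero (fun u : m → F => ∑ v : n → F, ψ (u ⬝ᵥ (z *ᵥ v)) - 1), sum_sub_distrib,
    sum_sum_apply hψ]
  simp only [zero_dotProduct, AddChar.map_zero_eq_one, sum_const, card_univ,
    Fintype.card_fun, nsmul_eq_mul, mul_one, phi]
  push_cast
  rw [mul_div_cancel₀ _ hq]
  ring

end Characters

/-! ### Spectrum of the graph and the explicit idempotent. -/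

section Spectrum

open scoped Classical
open Finset

variable {F : Type*} [Field F] [Fintype F] {D N : ℕ} {ψ : AddChar F ℂ}

/-- The dual eigenvalues as a function of the distance. -/
noncomputable def dual (F : Type*) [Fintype F] (D N i : ℕ) : ℝ :=
  phi (Fintype.card F) D (N - D) i

theorem dual_strictAnti (F : Type*) [Field F] [Fintype F] (D N : ℕ) : StrictAnti (dual F D N) :=
  phi_strictAnti (by exact_mod_cast Fintype.one_lt_card) _ _

theorem sum_rank_one_chi_vertex (hψ : ψ.IsPrimitive) (z : Vertex F D N) :
    ∑ C : Vertex F D N with C.rank = 1, chi ψ C z = (dual F D N z.rank : ℂ) := by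
  rw [sum_rank_one_chi hψ, Fintype.card_fin, Fintype.card_fin, dual]

theorem adjMat_apply (x y : Vertex F D N) :
    adjMat F D N x y = if (x - y).rank = 1 then 1 else 0 := by
  rw [adjMat, SimpleGraph.adjMatrix_apply]
  exact if_congr Iff.rfl rfl rfl

/-- For a Cayley graph, the eigenvalue of a character is its sum over the connection set; `chi_comm`
turns this into a sum of characters of rank one evaluated at `C`. -/
theorem sum_adjMat_mul_chi (hψ : ψ.IsPrimitive) (C x : Vertex F D N) :
    ∑ y, (adjMat F D N x y : ℂ) * chi ψ C y = dual F D N C.rank * chi ψ C x := by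
  rw [← sum_rank_one_chi_vertex hψ, sum_mul, sum_filter,
    ← Equiv.sum_comp (Equiv.addRight x) fun y => (adjMat F D N x y : ℂ) * chi ψ C y]
  refine sum_congr rfl fun y _ => ?_
  rw [adjMat_apply, Equiv.coe_addRight, rank_sub_comm, add_sub_cancel_right, chi_add_right,
    chi_comm ψ y]
  split_ifs <;> simp

/-- The Fourier transform of a real function on the vertex set. -/
noncomputable def fourier (ψ : AddChar F ℂ) (u : Vertex F D N → ℝ) (C : Vertex F D N) : ℂ :=
  ∑ z, chi ψ C z * u z

theorem sum_chi_mul_fourier (hψ : ψ.IsPrimitive) (u : Vertex F D N → ℝ) (x : Vertex F D N) :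
    ∑ C, chi ψ C (-x) * fourier ψ u C = (Fintype.card (Vertex F D N) : ℂ) * u x := by
  simp only [fourier, mul_sum]
  rw [sum_comm, sum_eq_single x]
  · simp only [← mul_assoc, ← chi_add_right, ← sum_mul, neg_add_cancel, chi_zero_right,
      sum_const, card_univ, nsmul_eq_mul, mul_one]
  · intro z _ hz
    simp only [← mul_assoc, ← chi_add_right, ← sum_mul]
    rw [sum_chi hψ, if_neg, zero_mul]
    rwa [neg_add_eq_zero, eq_comm]
  · simp

theorem adjMat_comm (x y : Vertex F D N) : adjMat F D N x y = adjMat F D N y x := by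
  rw [adjMat_apply, adjMat_apply, rank_sub_comm]

/-- Since `A` is symmetric, pairing `A u` with the character gives both `dual C.rank` and `η` times
the same coefficient. -/
theorem fourier_eigenvector (hψ : ψ.IsPrimitive) {u : Vertex F D N → ℝ} {η : ℝ}
    (h : adjMat F D N *ᵥ u = η • u) (C : Vertex F D N) (hη : dual F D N C.rank ≠ η) :
    fourier ψ u C = 0 := by
  have e : (dual F D N C.rank : ℂ) * fourier ψ u C = η * fourier ψ u C := by
    simp only [fourier, mul_sum, ← mul_assoc, ← sum_adjMat_mul_chi hψ, sum_mul]
    rw [sum_comm]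
    refine sum_congr rfl fun z _ => ?_
    have hz := congrArg (Complex.ofReal) (congrFun h z)
    simp only [mulVec, dotProduct, Pi.smul_apply, smul_eq_mul] at hz
    push_cast at hz
    rw [mul_right_comm, ← hz, sum_mul]
    refine sum_congr rfl fun w _ => ?_
    rw [adjMat_comm]
    ring
  rw [← sub_eq_zero, ← sub_mul, mul_eq_zero, sub_eq_zero, Complex.ofReal_inj] at e
  exact e.resolve_left hη

/-- The explicit form of the idempotent. -/
noncomputable def idem (F : Type*) [Field F] [Fintype F] (D N : ℕ) :
    Matrix (Vertex F D N) (Vertex F D N) ℝ :=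
  fun x y => (Fintype.card (Vertex F D N) : ℝ)⁻¹ * dual F D N (x - y).rank

theorem idem_apply (hψ : ψ.IsPrimitive) (x y : Vertex F D N) : (idem F D N x y : ℂ) =
    (Fintype.card (Vertex F D N) : ℂ)⁻¹ * ∑ C : Vertex F D N with C.rank = 1, chi ψ C (x - y) := by
  rw [sum_rank_one_chi_vertex hψ, idem]
  push_cast
  rfl

theorem idem_comm (x y : Vertex F D N) : idem F D N x y = idem F D N y x := by
  rw [idem, idem, rank_sub_comm]

theorem card_vertex_ne_zero : (Fintype.card (Vertex F D N) : ℂ) ≠ 0 :=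
  Nat.cast_ne_zero.2 Fintype.card_ne_zero

theorem idem_mulVec_apply (hψ : ψ.IsPrimitive) (u : Vertex F D N → ℝ) (x : Vertex F D N) :
    (((idem F D N *ᵥ u) x : ℝ) : ℂ) = (Fintype.card (Vertex F D N) : ℂ)⁻¹ *
      ∑ C : Vertex F D N with C.rank = 1, chi ψ C (-x) * fourier ψ u C := by
  simp only [mulVec, dotProduct, fourier]
  push_cast
  simp only [idem_comm x, idem_apply hψ, mul_sum, sum_mul]
  rw [sum_comm]
  refine sum_congr rfl fun C _ => sum_congr rfl fun y _ => ?_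
  rw [sub_eq_neg_add, chi_add_right]
  ring

/-- `idem` keeps the Fourier coefficients of rank one and drops the others. By strict monotonicity
of `dual`, only rank one has eigenvalue `dual 1`. -/
theorem isPrimitiveIdempotent_idem :
    IsPrimitiveIdempotent (adjMat F D N) (dual F D N 1) (idem F D N) := by
  obtain ⟨ψ, hψ⟩ := exists_primitive_addChar F
  constructor
  · intro u hu
    funext x
    apply Complex.ofReal_injective
    rw [idem_mulVec_apply hψ, sum_filter_of_ne, sum_chi_mul_fourier hψ,
      inv_mul_cancel_left₀ card_vertex_ne_zero]
    intro C _ hC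
    by_contra h
    exact hC (by rw [fourier_eigenvector hψ hu C ((dual_strictAnti F D N).injective.ne h),
      mul_zero])
  · intro η hη u hu
    funext x
    apply Complex.ofReal_injective
    rw [idem_mulVec_apply hψ, sum_eq_zero, mul_zero]
    · simp
    · intro C hC
      rw [fourier_eigenvector hψ hu C, mul_zero]
      rw [(mem_filter.1 hC).2]
      exact hη.symm

/-- Otherwise all Fourier coefficients of an eigenvector would vanish. -/
theorem exists_eq_dual {η : ℝ} (h : η ∈ eigenvalueFinset (adjMat F D N)) :
    ∃ i, η = dual F D N i := by
  obtain ⟨ψ, hψ⟩ := exists_primitive_addChar F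
  rw [eigenvalueFinset, Multiset.mem_toFinset, Polynomial.mem_roots', ← minpoly_toLin'] at h
  obtain ⟨u, hu, hu0⟩ := (Module.End.hasEigenvalue_of_isRoot h.2).exists_hasEigenvector
  rw [Module.End.mem_eigenspace_iff, toLin'_apply] at hu
  by_contra! hne
  refine hu0 (funext fun x => ?_)
  have := sum_chi_mul_fourier hψ u x
  rw [sum_eq_zero, eq_comm, mul_eq_zero, or_iff_right card_vertex_ne_zero] at this
  · exact_mod_cast this
  · intro C _
    rw [fourier_eigenvector hψ hu C (hne _).symm, mul_zero]

theorem dual_zero_mem : dual F D N 0 ∈ eigenvalueFinset (adjMat F D N) := by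
  obtain ⟨ψ, hψ⟩ := exists_primitive_addChar F
  refine mem_eigenvalueFinset (v := 1) one_ne_zero ?_
  funext x
  apply Complex.ofReal_injective
  have := sum_adjMat_mul_chi hψ 0 x
  simp only [chi_zero_left, rank_zero, mul_one] at this
  simp only [mulVec, dotProduct, Pi.smul_apply, Pi.one_apply, mul_one, smul_eq_mul]
  push_cast
  exact this

theorem dual_zero_pos (hD : 0 < D) (hN : 0 < N - D) : 0 < dual F D N 0 := by
  have hq : (1 : ℝ) < Fintype.card F := by exact_mod_cast Fintype.one_lt_card
  have h1 : (1 : ℝ) < (Fintype.card F : ℝ) ^ D := one_lt_pow₀ hq hD.ne'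
  have h2 : (1 : ℝ) < (Fintype.card F : ℝ) ^ (N - D) := one_lt_pow₀ hq hN.ne'
  have : dual F D N 0 = (((Fintype.card F : ℝ) ^ D - 1) * ((Fintype.card F : ℝ) ^ (N - D) - 1)) /
      ((Fintype.card F : ℝ) - 1) := by
    rw [dual, phi, pow_add, pow_zero]
    congr 1
    ring
  rw [this]
  exact div_pos (mul_pos (sub_pos.2 h1) (sub_pos.2 h2)) (sub_pos.2 hq)

theorem dual_one_mem (hD : 0 < D) (hN : 0 < N - D) :
    dual F D N 1 ∈ eigenvalueFinset (adjMat F D N) := by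
  obtain ⟨ψ, hψ⟩ := exists_primitive_addChar F
  refine mem_eigenvalueFinset (v := fun z => idem F D N z 0) ?_ ?_
  · intro h
    have := congrFun h 0
    simp only [idem, sub_zero, rank_zero, Pi.zero_apply, mul_eq_zero, inv_eq_zero,
      Nat.cast_eq_zero] at this
    exact this.elim Fintype.card_ne_zero (dual_zero_pos hD hN).ne'
  · funext x
    apply Complex.ofReal_injective
    simp only [mulVec, dotProduct, Pi.smul_apply, smul_eq_mul]
    push_cast
    simp only [idem_apply hψ, sub_zero, mul_sum]
    rw [sum_comm]
    refine sum_congr rfl fun C hC => ?_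
    have := sum_adjMat_mul_chi hψ C x
    rw [(mem_filter.1 hC).2] at this
    rw [mul_left_comm, ← this, mul_sum]
    exact sum_congr rfl fun y _ => by ring

theorem sort_getD_one {s : Finset ℝ} {a b : ℝ} (ha : a ∈ s) (hb : b ∈ s) (hba : b < a)
    (h : ∀ c ∈ s, c ≠ a → c ≤ b) : (s.sort (· ≥ ·)).getD 1 0 = b := by
  have h1 : s = insert a (insert b ((s.erase a).erase b)) := by
    rw [insert_erase (mem_erase.2 ⟨hba.ne, hb⟩), insert_erase ha]
  rw [h1, sort_insert, sort_insert]
  · rfl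
  · intro c hc
    simp only [mem_erase] at hc
    exact h c hc.2.2 hc.2.1
  · simp
  · intro c hc
    simp only [mem_insert, mem_erase] at hc
    rcases hc with rfl | hc
    · exact hba.le
    · exact (h c hc.2.2 hc.2.1).trans hba.le
  · simp [hba.ne']

/-- Every eigenvalue is some `dual i`, so it suffices that `dual 0` and `dual 1` are attained and
that `dual` decreases. -/
theorem theta_one (hD : 0 < D) (hN : 0 < N - D) : theta (adjMat F D N) 1 = dual F D N 1 := by
  refine sort_getD_one dual_zero_mem (dual_one_mem hD hN) (dual_strictAnti F D N one_pos) ?_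
  intro c hc hne
  obtain ⟨i, rfl⟩ := exists_eq_dual hc
  refine (dual_strictAnti F D N).antitone (Nat.one_le_iff_ne_zero.2 ?_)
  rintro rfl
  exact hne rfl

theorem isSymm_adjMat : (adjMat F D N).IsSymm := by
  ext x y
  exact adjMat_comm y x

theorem E_eq_idem (hD : 0 < D) (hN : 0 < N - D) : E F D N = idem F D N := by
  refine IsPrimitiveIdempotent.unique isSymm_adjMat (θ := dual F D N 1) ?_
    isPrimitiveIdempotent_idem
  rw [E, theta_one hD hN]
  convert isPrimitiveIdempotent_primitiveIdempotent _ _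

theorem idem_mulVec_chi (hψ : ψ.IsPrimitive) (C x : Vertex F D N) :
    ∑ y, (idem F D N x y : ℂ) * chi ψ C y = if C.rank = 1 then chi ψ C x else 0 := by
  simp only [idem_apply hψ, mul_sum, sum_mul]
  rw [sum_comm]
  have key : ∀ C' : Vertex F D N, ∑ y, (Fintype.card (Vertex F D N) : ℂ)⁻¹ * chi ψ C' (x - y) *
      chi ψ C y = if C = C' then chi ψ C x else 0 := by
    intro C'
    have e : ∀ y, (Fintype.card (Vertex F D N) : ℂ)⁻¹ * chi ψ C' (x - y) * chi ψ C y =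
        (Fintype.card (Vertex F D N) : ℂ)⁻¹ * chi ψ C' x * chi ψ y (C - C') := by
      intro y
      have h1 : chi ψ C y = chi ψ (C - C') y * chi ψ C' y := by
        rw [← chi_add_left, sub_add_cancel]
      have h2 : chi ψ C' x = chi ψ C' (x - y) * chi ψ C' y := by
        rw [← chi_add_right, sub_add_cancel]
      rw [h1, h2, chi_comm ψ y]
      ring
    simp only [e]
    rw [← mul_sum, sum_chi hψ]
    simp only [sub_eq_zero]
    split_ifs with h
    · rw [h, mul_right_comm, inv_mul_cancel₀ card_vertex_ne_zero, one_mul]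
    · rw [mul_zero]
  simp only [key]
  rw [sum_ite_eq]
  simp

end Spectrum

/-! ### The weights and their cancellations. -/

/-- The weights of the six classes. -/
noncomputable def weight (q : ℝ) (d e k : ℕ) : Fin 6 → ℝ :=
  ![(q ^ d - q ^ k) * (q ^ e - q ^ k) * (q ^ k / q - 1) / (q ^ k * (q - 1)),
    (q ^ d - q ^ k) * (q ^ e - q ^ k) / (q * (q - 1)),
    (q ^ d - q ^ k) * (q ^ e - q ^ k) * (q ^ k / q - 1) / (q ^ k * (q - 1)),
    -((q ^ d - q ^ k) * (q ^ k / q - 1) / (q - 1)),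
    -((q ^ e - q ^ k) * (q ^ k / q - 1) / (q - 1)),
    (q ^ k - 1) * (q ^ k / q - 1) / (q - 1)]

theorem weight_zero_eq_two (q : ℝ) (d e k : ℕ) : weight q d e k 0 = weight q d e k 2 := rfl

theorem weight_swap (q : ℝ) (d e k : ℕ) (i : Fin 6) :
    weight q e d k (Equiv.swap 3 4 i) = weight q d e k i := by
  have h1 : Equiv.swap (3 : Fin 6) 4 0 = 0 := by decide
  have h2 : Equiv.swap (3 : Fin 6) 4 1 = 1 := by decide
  have h3 : Equiv.swap (3 : Fin 6) 4 2 = 2 := by decide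
  have h4 : Equiv.swap (3 : Fin 6) 4 3 = 4 := by decide
  have h5 : Equiv.swap (3 : Fin 6) 4 4 = 3 := by decide
  have h6 : Equiv.swap (3 : Fin 6) 4 5 = 5 := by decide
  fin_cases i <;> simp [h1, h2, h3, h4, h5, h6, weight, mul_comm]

/-- The truncated exponent `k - 1` is traded for a division by `q`, so that later identities are
rational in `q`, `q ^ d`, `q ^ e` and `q ^ k`. -/
theorem H_apply_five (q : ℝ) (D N : ℕ) {k : ℕ} (hq : q ≠ 0) (hk : k ≠ 0) (i : Fin 6) :
    H q D N k i 5 = weight q D (N - D) k i := by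
  have : q ^ (k - 1) = q ^ k / q := by
    rw [eq_div_iff hq, pow_sub_one_mul hk]
  fin_cases i <;> simp [H, weight, this]

section WeightSums

open scoped Classical
open Finset

variable {F : Type*} [Field F] [Fintype F] {m n : Type*} [Fintype m] [Fintype n]
  [DecidableEq m] [DecidableEq n] {a : Matrix m n F} {G : Matrix n m F}

theorem sum_ne_zero_mem {V : Type*} [AddCommGroup V] [Module F V] [Fintype V] [DecidableEq V]
    (S : Submodule F V) (f : V → ℝ) :
    ∑ v with v ≠ 0 ∧ v ∈ S, f v = ∑ v with v ∈ S, f v - f 0 := by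
  have : ({v | v ≠ 0 ∧ v ∈ S} : Finset V) = ({v | v ∈ S} : Finset V).erase 0 := by
    ext v
    simp
  rw [this, sum_erase_eq_sub]
  simp

/-- Because `w 0 = w 2`, the weight is a combination of the constant function and the indicators of
the row space and of its trace-zero part. At `v = 0` this combination equals `w 1`, which is
subtracted. -/
theorem sum_cls_of_mem (hG : a * G * a = a) {w : Fin 6 → ℝ} (hw : w 0 = w 2) {u : m → F}
    (hu : u ≠ 0) (hua : u ∈ colSp a) (S : Submodule F (n → F)) :
    ∑ v with v ≠ 0 ∧ v ∈ S, w (cls a G (vecMulVec u v)) =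
      #{v | v ∈ S} * w 3 + #{v | v ∈ S ∧ v ∈ colSp aᵀ} * (w 0 - w 3) +
        #{v | v ∈ S ∧ v ∈ colSp aᵀ ∧ v ⬝ᵥ (G *ᵥ u) = 0} * (w 1 - w 0) - w 1 := by
  have e : ∀ v ∈ ({v | v ≠ 0 ∧ v ∈ S} : Finset (n → F)), w (cls a G (vecMulVec u v)) =
      w 3 + (if v ∈ colSp aᵀ then w 0 - w 3 else 0) +
        (if v ∈ colSp aᵀ ∧ v ⬝ᵥ (G *ᵥ u) = 0 then w 1 - w 0 else 0) := by
    intro v hv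
    rw [mem_filter] at hv
    rw [cls_vecMulVec hG hu hv.2.1, if_pos hua]
    by_cases h1 : v ∈ colSp aᵀ
    · by_cases h2 : v ⬝ᵥ (G *ᵥ u) = 0
      · simp [h1, h2]
      · by_cases h3 : v ⬝ᵥ (G *ᵥ u) = 1
        · simp [h1, h3]
        · simp [h1, h2, h3, hw]
    · simp [h1]
  rw [sum_congr rfl e, sum_ne_zero_mem S, sum_add_distrib, sum_add_distrib, ← sum_filter,
    ← sum_filter, filter_filter, filter_filter]
  simp only [sum_const, nsmul_eq_mul, Submodule.zero_mem, zero_dotProduct, true_and, if_true]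
  ring

theorem sum_cls_of_notMem (hG : a * G * a = a) (w : Fin 6 → ℝ) {u : m → F}
    (hua : u ∉ colSp a) (S : Submodule F (n → F)) :
    ∑ v with v ≠ 0 ∧ v ∈ S, w (cls a G (vecMulVec u v)) =
      #{v | v ∈ S} * w 5 + #{v | v ∈ S ∧ v ∈ colSp aᵀ} * (w 4 - w 5) - w 4 := by
  have hu : u ≠ 0 := by rintro rfl; exact hua (Submodule.zero_mem _)
  have e : ∀ v ∈ ({v | v ≠ 0 ∧ v ∈ S} : Finset (n → F)), w (cls a G (vecMulVec u v)) =
      w 5 + (if v ∈ colSp aᵀ then w 4 - w 5 else 0) := by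
    intro v hv
    rw [mem_filter] at hv
    rw [cls_vecMulVec hG hu hv.2.1, if_neg hua]
    by_cases h1 : v ∈ colSp aᵀ <;> simp [h1]
  rw [sum_congr rfl e, sum_ne_zero_mem S, sum_add_distrib, ← sum_filter, filter_filter]
  simp only [sum_const, nsmul_eq_mul, Submodule.zero_mem, if_true]
  ring

theorem cast_card_eq_div {V : Type*} [AddCommGroup V] [Module F V] [Fintype V]
    (K : Submodule F V) (f : V →ₗ[F] F) {x₀ : V} (hx₀ : x₀ ∈ K) (hf : f x₀ ≠ 0) :
    ((#{v : V | v ∈ K ∧ f v = 0} : ℕ) : ℝ) = ((#{v : V | v ∈ K} : ℕ) : ℝ) / Fintype.card F := by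
  rw [eq_div_iff (Nat.cast_ne_zero.2 Fintype.card_ne_zero)]
  exact_mod_cast card_mem_and_eq_mul_card K f hx₀ hf 0

theorem cast_card_mem_colSp (a : Matrix m n F) :
    ((#{u : m → F | u ∈ colSp a} : ℕ) : ℝ) = (Fintype.card F : ℝ) ^ a.rank := by
  rw [card_mem_colSp]
  push_cast
  rfl

/-- The weight of a matrix of rank one relative to `a`. -/
noncomputable def wt (a : Matrix m n F) (G : Matrix n m F) (B : Matrix m n F) : ℝ :=
  weight (Fintype.card F) (Fintype.card m) (Fintype.card n) a.rank (cls a G B)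

theorem wt_transpose (a B : Matrix m n F) (G : Matrix n m F) : wt aᵀ Gᵀ Bᵀ = wt a G B := by
  rw [wt, wt, rank_transpose, cls_transpose, weight_swap]

theorem wt_smul {c : F} (hc : c ≠ 0) (B : Matrix m n F) : wt a G (c • B) = wt a G B :=
  apply_cls_smul (weight_zero_eq_two _ _ _ _) hc

theorem wt_neg (a B : Matrix m n F) (G : Matrix n m F) : wt (-a) (-G) B = wt a G B := by
  rw [wt, wt, rank_neg']
  exact apply_cls_neg (weight_zero_eq_two _ _ _ _)

theorem one_lt_cast_card : (1 : ℝ) < Fintype.card F := by exact_mod_cast Fintype.one_lt_card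

/-- With all of `F ^ n` as subspace, the counts are `q ^ n`, `q ^ k` and `q ^ k / q`, and the
weights satisfy the resulting identity in both cases for `u`. -/
theorem sum_wt_right (hG : a * G * a = a) {u : m → F} (hu : u ≠ 0) :
    ∑ v : n → F with v ≠ 0, wt a G (vecMulVec u v) = 0 := by
  have hq := one_lt_cast_card (F := F)
  have hq1 : (Fintype.card F : ℝ) - 1 ≠ 0 := (sub_pos.2 hq).ne'
  have hq0 : (Fintype.card F : ℝ) ≠ 0 := by positivity
  have e : ({v | v ≠ 0} : Finset (n → F)) =
      ({v | v ≠ 0 ∧ v ∈ (⊤ : Submodule F (n → F))} : Finset (n → F)) := by simp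
  have c1 : ((#{v | v ∈ (⊤ : Submodule F (n → F))} : ℕ) : ℝ) =
      (Fintype.card F : ℝ) ^ Fintype.card n := by
    simp
  have c2 : ((#{v | v ∈ (⊤ : Submodule F (n → F)) ∧ v ∈ colSp aᵀ} : ℕ) : ℝ) =
      (Fintype.card F : ℝ) ^ a.rank := by
    rw [← rank_transpose, ← cast_card_mem_colSp]
    simp
  simp only [wt]
  rw [e]
  by_cases hua : u ∈ colSp a
  · have c3 : ((#{v | v ∈ (⊤ : Submodule F (n → F)) ∧ v ∈ colSp aᵀ ∧ v ⬝ᵥ (G *ᵥ u) = 0} : ℕ) : ℝ)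
        = (Fintype.card F : ℝ) ^ a.rank / Fintype.card F := by
      obtain ⟨v₀, hv₀, h⟩ := exists_mem_dotProduct_ne_zero hG hu hua
      have := cast_card_eq_div (colSp aᵀ) (dotFun (G *ᵥ u)) hv₀ h
      rw [cast_card_mem_colSp, rank_transpose] at this
      simp only [Submodule.mem_top, true_and]
      convert this
      rfl
    rw [sum_cls_of_mem hG (weight_zero_eq_two _ _ _ _) hu hua, c1, c2, c3]
    simp only [weight, Matrix.cons_val]
    field_simp
    ring
  · rw [sum_cls_of_notMem hG _ hua, c1, c2]
    simp only [weight, Matrix.cons_val]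
    field_simp
    ring

theorem sum_wt_left (hG : a * G * a = a) {v : n → F} (hv : v ≠ 0) :
    ∑ u : m → F with u ≠ 0, wt a G (vecMulVec u v) = 0 := by
  have := sum_wt_right (transpose_generalized_inverse hG) hv
  refine (sum_congr rfl fun u _ => ?_).trans this
  rw [← wt_transpose, transpose_vecMulVec]

theorem cast_card_ker_dotFun {p : n → F} (hp : p ≠ 0) :
    ((#{v : n → F | v ∈ LinearMap.ker (dotFun p)} : ℕ) : ℝ) =
      (Fintype.card F : ℝ) ^ Fintype.card n / Fintype.card F := by
  obtain ⟨v, hv⟩ : ∃ v, dotFun p v ≠ 0 := by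
    by_contra! h'
    exact hp (dotFun_eq_zero_iff.1 (LinearMap.ext h'))
  have := cast_card_eq_div ⊤ (dotFun p) (Submodule.mem_top (x := v)) hv
  simp only [Submodule.mem_top, true_and, filter_true, card_univ, Fintype.card_fun] at this
  push_cast at this
  rw [← this]
  congr

theorem cast_card_ker_dotFun_inter (b : Matrix m n F) {p x₀ : m → F} (h1 : x₀ ∈ colSp b)
    (h2 : x₀ ⬝ᵥ p ≠ 0) :
    ((#{v : m → F | v ∈ LinearMap.ker (dotFun p) ∧ v ∈ colSp b} : ℕ) : ℝ) =
      (Fintype.card F : ℝ) ^ b.rank / Fintype.card F := by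
  rw [← cast_card_mem_colSp, ← cast_card_eq_div (colSp b) (dotFun p) h1 h2]
  simp only [LinearMap.mem_ker, and_comm]

/-- The weights sum to zero over the pairs `u ⊥ s`, `v ⊥ t` whenever `s ⬝ a t ≠ 0`. -/
theorem sum_wt_perp (hG : a * G * a = a) {s : m → F} {t : n → F} (hst : s ⬝ᵥ (a *ᵥ t) ≠ 0) :
    ∑ u : m → F with u ≠ 0 ∧ u ⬝ᵥ s = 0, ∑ v : n → F with v ≠ 0 ∧ v ⬝ᵥ t = 0,
      wt a G (vecMulVec u v) = 0 := by
  have hq := one_lt_cast_card (F := F)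
  have hq1 : (Fintype.card F : ℝ) - 1 ≠ 0 := (sub_pos.2 hq).ne'
  have hq0 : (Fintype.card F : ℝ) ≠ 0 := by positivity
  have hs : s ≠ 0 := by rintro rfl; simp at hst
  have ht : t ≠ 0 := by rintro rfl; simp at hst
  have hts : (aᵀ *ᵥ s) ⬝ᵥ t ≠ 0 := by rwa [mulVec_transpose, ← dotProduct_mulVec]
  have memT : ∀ {v : n → F}, v ∈ LinearMap.ker (dotFun t) ↔ v ⬝ᵥ t = 0 := Iff.rfl
  have memS : ∀ {u : m → F}, u ∈ LinearMap.ker (dotFun s) ↔ u ⬝ᵥ s = 0 := Iff.rfl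
  have cT := cast_card_ker_dotFun ht
  have cS := cast_card_ker_dotFun hs
  have cTK := cast_card_ker_dotFun_inter aᵀ (p := t) ⟨s, rfl⟩ hts
  have cSK := cast_card_ker_dotFun_inter a (p := s) ⟨t, rfl⟩ (by rwa [mulVecLin_apply, dotProduct_comm])
  rw [rank_transpose] at cTK
  set q : ℝ := (Fintype.card F : ℝ)
  set w := weight q (Fintype.card m) (Fintype.card n) a.rank with hw
  have inner : ∀ u ∈ ({u | u ≠ 0 ∧ u ∈ LinearMap.ker (dotFun s)} : Finset (m → F)),
      ∑ v : n → F with v ≠ 0 ∧ v ∈ LinearMap.ker (dotFun t), w (cls a G (vecMulVec u v)) =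
      (q ^ Fintype.card n / q * w 5 + q ^ a.rank / q * (w 4 - w 5) - w 4) +
      if u ∈ colSp a then
        (q ^ Fintype.card n / q * w 3 + q ^ a.rank / q * (w 0 - w 3) +
          q ^ a.rank / q / q * (w 1 - w 0) - w 1) -
        (q ^ Fintype.card n / q * w 5 + q ^ a.rank / q * (w 4 - w 5) - w 4) else 0 := by
    intro u hu
    rw [mem_filter] at hu
    split_ifs with hua
    · have c3 : ((#{v | v ∈ LinearMap.ker (dotFun t) ∧ v ∈ colSp aᵀ ∧ v ⬝ᵥ (G *ᵥ u) = 0} : ℕ) : ℝ)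
          = q ^ a.rank / q / q := by
        obtain ⟨i, hi⟩ := Function.ne_iff.1 hu.2.1
        -- A basis vector `e i` with `u i ≠ 0`, corrected by a multiple of `s` to make `aᵀ r`
        -- orthogonal to `t`. Since `u ⊥ s`, the correction leaves `r ⬝ u = u i`, so the trace
        -- condition is a further independent one.
        obtain ⟨r, hr⟩ : ∃ r : m → F,
            r = Pi.single i 1 - ((a *ᵥ t) i / (s ⬝ᵥ (a *ᵥ t))) • s := ⟨_, rfl⟩
        have hr1 : (aᵀ *ᵥ r) ⬝ᵥ t = 0 := by
          rw [mulVec_transpose, ← dotProduct_mulVec, hr, sub_dotProduct, smul_dotProduct, smul_eq_mul,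
            div_mul_cancel₀ _ hst]
          simp
        have hr2 : (aᵀ *ᵥ r) ⬝ᵥ (G *ᵥ u) ≠ 0 := by
          rw [mulVec_transpose, ← dotProduct_mulVec, (mem_colSp_iff hG).1 hua, hr, sub_dotProduct,
            smul_dotProduct, dotProduct_comm s u, memS.1 hu.2.2]
          simpa using hi
        have := cast_card_eq_div (LinearMap.ker (dotFun t) ⊓ colSp aᵀ) (dotFun (G *ᵥ u))
          (Submodule.mem_inf.2 ⟨memT.2 hr1, ⟨r, rfl⟩⟩) hr2
        simp only [Submodule.mem_inf, dotFun_apply, and_assoc] at this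
        rw [this, cTK]
      rw [sum_cls_of_mem hG (weight_zero_eq_two _ _ _ _) hu.2.1 hua, cT, cTK, c3]
      ring
    · rw [sum_cls_of_notMem hG _ hua, cT, cTK, add_zero]
  -- The right side of `inner` also makes sense at `u = 0`, which lies in the column space; that
  -- value is subtracted.
  have outer := (sum_congr rfl inner).trans (sum_ne_zero_mem _ _)
  rw [sum_add_distrib, ← sum_filter, filter_filter, sum_const, sum_const,
    if_pos (Submodule.zero_mem _), nsmul_eq_mul, nsmul_eq_mul, cS, cSK] at outer
  refine outer.trans ?_
  simp only [hw, weight, Matrix.cons_val]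
  field_simp
  ring

end WeightSums

/-! ### The Fourier transform of the weight. -/

section DualWeight

open scoped Classical
open Finset

variable {F : Type*} [Field F] [Fintype F] {m n : Type*} [Fintype m] [Fintype n]
  [DecidableEq m] [DecidableEq n] {a : Matrix m n F} {G : Matrix n m F} {ψ : AddChar F ℂ}

/-- The Fourier transform of the weight on matrices of rank one. -/
noncomputable def dualWeight (ψ : AddChar F ℂ) (a : Matrix m n F) (G : Matrix n m F)
    (C : Matrix m n F) : ℂ :=
  ∑ B with B.rank = 1, (wt a G B : ℂ) * chi ψ C (-B)

theorem card_sub_one_ne_zero : (Fintype.card F : ℂ) - 1 ≠ 0 := by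
  rw [sub_ne_zero]
  exact_mod_cast Fintype.one_lt_card.ne'

theorem chi_vecMulVec_neg_vecMulVec (s u : m → F) (t v : n → F) :
    chi ψ (vecMulVec s t) (-vecMulVec u v) = ψ (-((u ⬝ᵥ s) * (v ⬝ᵥ t))) := by
  rw [chi_vecMulVec, neg_mulVec, vecMulVec_mulVec, dotProduct_neg, dotProduct_comm s]
  congr 2
  simp [mul_comm]

theorem dualWeight_neg (C : Matrix m n F) : dualWeight ψ (-a) (-G) C = dualWeight ψ a G C := by
  simp only [dualWeight, wt_neg]

theorem dualWeight_smul {c : F} (hc : c ≠ 0) (C : Matrix m n F) :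
    dualWeight ψ a G (c • C) = dualWeight ψ a G C := by
  refine sum_nbij' (fun B => c • B) (fun B => c⁻¹ • B) ?_ ?_ ?_ ?_ ?_
  · intro B hB
    simpa [rank_smul' hc] using hB
  · intro B hB
    simpa [rank_smul' (inv_ne_zero hc)] using hB
  · intro B _
    rw [smul_smul, inv_mul_cancel₀ hc, one_smul]
  · intro B _
    rw [smul_smul, mul_inv_cancel₀ hc, one_smul]
  · intro B _
    rw [wt_smul hc, chi_smul_comm, smul_neg]

theorem sum_wt_right_complex (hG : a * G * a = a) {u : m → F} (hu : u ≠ 0) :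
    ∑ v : n → F with v ≠ 0, (wt a G (vecMulVec u v) : ℂ) = 0 := by
  exact_mod_cast congrArg Complex.ofReal (sum_wt_right hG hu)

theorem sum_wt_left_complex (hG : a * G * a = a) {v : n → F} (hv : v ≠ 0) :
    ∑ u : m → F with u ≠ 0, (wt a G (vecMulVec u v) : ℂ) = 0 := by
  exact_mod_cast congrArg Complex.ofReal (sum_wt_left hG hv)

/-- Functions of only one of the two factors are orthogonal to the weight. -/
theorem sum_sum_wt_mul_left (hG : a * G * a = a) (f : (m → F) → ℂ) :
    ∑ u : m → F with u ≠ 0, ∑ v : n → F with v ≠ 0, (wt a G (vecMulVec u v) : ℂ) * f u = 0 := by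
  refine sum_eq_zero fun u hu => ?_
  rw [← sum_mul, sum_wt_right_complex hG (mem_filter.1 hu).2, zero_mul]

theorem sum_sum_wt_mul_right (hG : a * G * a = a) (f : (n → F) → ℂ) :
    ∑ u : m → F with u ≠ 0, ∑ v : n → F with v ≠ 0, (wt a G (vecMulVec u v) : ℂ) * f v = 0 := by
  rw [sum_comm]
  refine sum_eq_zero fun v hv => ?_
  rw [← sum_mul, sum_wt_left_complex hG (mem_filter.1 hv).2, zero_mul]

/-- For `v ≠ 0`, summing the character over `t` leaves a function of `u` alone, to which the weight
is orthogonal. -/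
theorem sum_dualWeight_right (hψ : ψ.IsPrimitive) (hG : a * G * a = a) (s : m → F) :
    ∑ t : n → F with t ≠ 0, dualWeight ψ a G (vecMulVec s t) = 0 := by
  refine mul_left_cancel₀ (card_sub_one_ne_zero (F := F)) ?_
  rw [mul_zero]
  simp only [dualWeight]
  rw [sum_comm]
  simp only [← mul_sum]
  rw [sum_rank_one]
  refine Eq.trans (sum_congr rfl fun u _ => sum_congr rfl fun v hv => congrArg _ ?_)
    (sum_sum_wt_mul_left hG fun u =>
      (if u ⬝ᵥ s = 0 then (Fintype.card F : ℂ) ^ Fintype.card n else 0) - 1)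
  have e : ∀ t : n → F, chi ψ (vecMulVec s t) (-vecMulVec u v) =
      ψ (t ⬝ᵥ (-(u ⬝ᵥ s)) • v) := by
    intro t
    rw [chi_vecMulVec_neg_vecMulVec, dotProduct_smul, dotProduct_comm t, smul_eq_mul, neg_mul]
  simp only [e]
  rw [sum_ne_zero, sum_apply_dotProduct hψ, zero_dotProduct, AddChar.map_zero_eq_one]
  simp [(mem_filter.1 hv).2]

theorem sum_dualWeight_left (hψ : ψ.IsPrimitive) (hG : a * G * a = a) (t : n → F) :
    ∑ s : m → F with s ≠ 0, dualWeight ψ a G (vecMulVec s t) = 0 := by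
  refine mul_left_cancel₀ (card_sub_one_ne_zero (F := F)) ?_
  rw [mul_zero]
  simp only [dualWeight]
  rw [sum_comm]
  simp only [← mul_sum]
  rw [sum_rank_one]
  refine Eq.trans (sum_congr rfl fun u hu => sum_congr rfl fun v _ => congrArg _ ?_)
    (sum_sum_wt_mul_right hG fun v =>
      (if v ⬝ᵥ t = 0 then (Fintype.card F : ℂ) ^ Fintype.card m else 0) - 1)
  have e : ∀ s : m → F, chi ψ (vecMulVec s t) (-vecMulVec u v) =
      ψ (s ⬝ᵥ (-(v ⬝ᵥ t)) • u) := by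
    intro s
    rw [chi_vecMulVec_neg_vecMulVec, dotProduct_smul, dotProduct_comm s, smul_eq_mul, neg_mul,
      mul_comm]
  simp only [e]
  rw [sum_ne_zero, sum_apply_dotProduct hψ, zero_dotProduct, AddChar.map_zero_eq_one]
  simp [(mem_filter.1 hu).2]

theorem sum_smul_dualWeight (C : Matrix m n F) :
    ∑ c : F with c ≠ 0, dualWeight ψ a G (c • C) =
      ((Fintype.card F : ℂ) - 1) * dualWeight ψ a G C := by
  rw [sum_congr rfl fun c hc => dualWeight_smul (mem_filter.1 hc).2 C, sum_const, nsmul_eq_mul,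
    cast_card_ne_zero]

/-- The dual weight vanishes on the matrices of rank one that are not orthogonal to `a`. -/
theorem dualWeight_eq_zero (hψ : ψ.IsPrimitive) (hG : a * G * a = a) {s : m → F} {t : n → F}
    (hst : s ⬝ᵥ (a *ᵥ t) ≠ 0) : dualWeight ψ a G (vecMulVec s t) = 0 := by
  -- One factor `q - 1` averages over the multiples of `C`, the other parametrizes the matrices `B`
  -- by pairs of vectors.
  refine (mul_eq_zero_iff_left (card_sub_one_ne_zero (F := F))).1
    ((mul_eq_zero_iff_left (card_sub_one_ne_zero (F := F))).1 ?_)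
  rw [← sum_smul_dualWeight]
  simp only [dualWeight]
  rw [sum_comm]
  simp only [← mul_sum]
  rw [sum_rank_one]
  -- The scalar sum is `q` times the indicator of `(u ⬝ s) (v ⬝ t) = 0`, minus `1`. Splitting the
  -- indicator by inclusion–exclusion leaves only the joint term to treat, and `sum_wt_perp` kills
  -- it.
  have e : ∀ u v, ∑ c : F with c ≠ 0, chi ψ (c • vecMulVec s t) (-vecMulVec u v) =
      ((Fintype.card F : ℂ) * (if u ⬝ᵥ s = 0 then 1 else 0) - 1) +
        (Fintype.card F : ℂ) * (if v ⬝ᵥ t = 0 then 1 else 0) -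
        (Fintype.card F : ℂ) * (if u ⬝ᵥ s = 0 then if v ⬝ᵥ t = 0 then 1 else 0 else 0) := by
    intro u v
    have e1 : ∀ c : F, chi ψ (c • vecMulVec s t) (-vecMulVec u v) =
        ψ (c * -((u ⬝ᵥ s) * (v ⬝ᵥ t))) := by
      intro c
      rw [← smul_vecMulVec, chi_vecMulVec_neg_vecMulVec, dotProduct_smul, smul_eq_mul]
      congr 1
      ring
    simp only [e1]
    rw [sum_ne_zero, AddChar.sum_mulShift _ hψ, zero_mul, AddChar.map_zero_eq_one]
    simp only [neg_eq_zero, mul_eq_zero]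
    split_ifs <;> simp_all
    ring
  simp only [e, mul_sub, mul_add, sum_sub_distrib, sum_add_distrib]
  have p0 := sum_sum_wt_mul_left hG (fun _ => (1 : ℂ))
  have p1 := sum_sum_wt_mul_left hG
    fun u => (Fintype.card F : ℂ) * (if u ⬝ᵥ s = 0 then 1 else 0)
  have p2 := sum_sum_wt_mul_right hG
    fun v => (Fintype.card F : ℂ) * (if v ⬝ᵥ t = 0 then 1 else 0)
  rw [p0, p1, p2]
  have p3 : ∑ u : m → F with u ≠ 0, ∑ v : n → F with v ≠ 0, (wt a G (vecMulVec u v) : ℂ) *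
      ((Fintype.card F : ℂ) * (if u ⬝ᵥ s = 0 then if v ⬝ᵥ t = 0 then 1 else 0 else 0)) =
      (Fintype.card F : ℂ) * ((∑ u : m → F with u ≠ 0 ∧ u ⬝ᵥ s = 0,
        ∑ v : n → F with v ≠ 0 ∧ v ⬝ᵥ t = 0, wt a G (vecMulVec u v) : ℝ) : ℂ) := by
    push_cast
    simp only [← filter_filter]
    rw [sum_filter (fun u => u ⬝ᵥ s = 0), mul_sum]
    refine sum_congr rfl fun u _ => ?_
    split_ifs
    · rw [sum_filter (fun v => v ⬝ᵥ t = 0), mul_sum]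
      refine sum_congr rfl fun v _ => ?_
      split_ifs <;> ring
    · simp
  rw [p3, sum_wt_perp hG hst]
  simp

/-- Both families of neighbours contribute zero. The overlap is subtracted as `(q - 1)` copies of
the value at `C`, and `C` itself once more. -/
theorem sum_neighbors_dualWeight (hψ : ψ.IsPrimitive) (hG : a * G * a = a) {C : Matrix m n F}
    (hC : C.rank = 1) : ∑ B with B.rank = 1 ∧ (C - B).rank = 1, dualWeight ψ a G B =
      -(Fintype.card F : ℂ) * dualWeight ψ a G C := by
  obtain ⟨s, t, hs, ht, rfl⟩ := rank_eq_one_iff.1 hC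
  rw [sum_neighbors _ hs ht, sum_dualWeight_right hψ hG, sum_dualWeight_left hψ hG,
    sum_smul_dualWeight]
  ring

/-- Either `s ⬝ a t = 0` and the character is trivial at `a`, or the dual weight is zero. -/
theorem dualWeight_mul_chi (hψ : ψ.IsPrimitive) (hG : a * G * a = a) {C : Matrix m n F}
    (hC : C.rank = 1) : dualWeight ψ a G C * chi ψ C a = dualWeight ψ a G C := by
  obtain ⟨s, t, hs, ht, rfl⟩ := rank_eq_one_iff.1 hC
  by_cases h : s ⬝ᵥ (a *ᵥ t) = 0
  · rw [chi_vecMulVec, h, AddChar.map_zero_eq_one, mul_one]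
  · rw [dualWeight_eq_zero hψ hG h, zero_mul]

end DualWeight

/-! ### The vector `ω`: symmetry, correction term and Norton product. -/

section Main

open scoped Classical
open Finset

variable {F : Type*} [Field F] [Fintype F] {D N : ℕ} {x y : Vertex F D N}
  {G : Matrix (Fin (N - D)) (Fin D) F}

theorem Hxy_apply_five (hk : (y - x).rank ≠ 0) (B : Vertex F D N) :
    Hxy D N x y (cls (y - x) G B) 5 = wt (y - x) G B := by
  rw [Hxy, dist_eq_rank, rank_sub_comm, H_apply_five _ _ _
    (Nat.cast_ne_zero.2 Fintype.card_ne_zero) hk, wt, Fintype.card_fin, Fintype.card_fin]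

theorem sum_part (hG : (y - x) * G * (y - x) = y - x) (hk : (y - x).rank ≠ 0)
    (hkD : (y - x).rank < D) (hN : D < N - D) (f : Vertex F D N → ℝ) :
    ∑ i, Hxy D N x y i 5 * ∑ p ∈ part D N x y i, f p =
      ∑ B : Vertex F D N with B.rank = 1, wt (y - x) G B * f (x + B) := by
  have e : ∀ i, part D N x y i =
      ({p | (p - x).rank = 1 ∧ cls (y - x) G (p - x) = i} : Finset (Vertex F D N)) := by
    intro i
    ext p
    rw [mem_part_iff hG hk hkD hN, mem_filter]
    simp
  simp only [e, mul_sum, sum_filter]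
  rw [sum_comm, ← Equiv.sum_comp (Equiv.addLeft x)]
  refine sum_congr rfl fun B _ => ?_
  simp only [Equiv.coe_addLeft, add_sub_cancel_left]
  by_cases hB : B.rank = 1
  · simp [hB, ← Hxy_apply_five hk]
  · simp [hB]

theorem hatSet_apply (S : Finset (Vertex F D N)) (p : Vertex F D N) :
    hatSet S p = if p ∈ S then 1 else 0 := by
  rw [hatSet, Finset.sum_apply]
  simp [hat, Pi.single_apply]

theorem mulVec_hatSet (M : Matrix (Vertex F D N) (Vertex F D N) ℝ) (S : Finset (Vertex F D N))
    (z : Vertex F D N) : (M *ᵥ hatSet S) z = ∑ p ∈ S, M z p := by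
  simp [mulVec, dotProduct, hatSet_apply]

theorem h_apply (hG : (y - x) * G * (y - x) = y - x) (hk : (y - x).rank ≠ 0)
    (hkD : (y - x).rank < D) (hN : D < N - D) (z : Vertex F D N) :
    h D N x y 5 z =
      ∑ B : Vertex F D N with B.rank = 1, wt (y - x) G B * idem F D N z (x + B) := by
  rw [← sum_part hG hk hkD hN, h, Finset.sum_apply]
  refine sum_congr rfl fun i _ => ?_
  rw [Pi.smul_apply, smul_eq_mul, EO, E_eq_idem (by omega) (by omega), mulVec_hatSet]

/-- Expanding each entry of `E` in characters and collecting the terms in `B` leaves the dual weight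
as coefficient. -/
theorem h_apply_eq_sum_chi {ψ : AddChar F ℂ} (hψ : ψ.IsPrimitive)
    (hG : (y - x) * G * (y - x) = y - x) (hk : (y - x).rank ≠ 0)
    (hkD : (y - x).rank < D) (hN : D < N - D) (z : Vertex F D N) :
    (h D N x y 5 z : ℂ) = (Fintype.card (Vertex F D N) : ℂ)⁻¹ *
      ∑ C : Vertex F D N with C.rank = 1, dualWeight ψ (y - x) G C * chi ψ C (z - x) := by
  rw [h_apply hG hk hkD hN]
  push_cast
  simp only [idem_apply hψ, dualWeight, mul_sum, sum_mul]
  rw [sum_comm]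
  refine sum_congr rfl fun C _ => sum_congr rfl fun B _ => ?_
  rw [← sub_sub, sub_eq_add_neg (z - x), chi_add_right]
  ring

/-- The expansions based at `x` and at `y` differ termwise by `chi ψ C (y - x)`, which the dual
weight absorbs. On the other side `-G` serves as generalized inverse of `x - y`. -/
theorem h_swap (hk : (y - x).rank ≠ 0) (hkD : (y - x).rank < D) (hN : D < N - D) :
    h D N x y 5 = h D N y x 5 := by
  obtain ⟨ψ, hψ⟩ := exists_primitive_addChar F
  obtain ⟨G, hG⟩ := exists_generalized_inverse (y - x)
  have hxy : x - y = -(y - x) := (neg_sub y x).symm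
  have hG' : (x - y) * -G * (x - y) = x - y := by
    simp only [hxy, Matrix.mul_neg, Matrix.neg_mul, neg_neg, hG]
  have hkr : (x - y).rank ≠ 0 := by rwa [rank_sub_comm]
  have hkDr : (x - y).rank < D := by rwa [rank_sub_comm]
  funext z
  apply Complex.ofReal_injective
  refine (h_apply_eq_sum_chi hψ hG hk hkD hN z).trans
    (Eq.trans ?_ (h_apply_eq_sum_chi hψ hG' hkr hkDr hN z).symm)
  refine congrArg _ (sum_congr rfl fun C hC => ?_)
  have e1 : dualWeight ψ (x - y) (-G) C = dualWeight ψ (y - x) G C := by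
    rw [hxy, dualWeight_neg]
  have e2 : chi ψ C (z - x) = chi ψ C (y - x) * chi ψ C (z - y) := by
    rw [← chi_add_right, add_comm, sub_add_sub_cancel]
  rw [e1, e2, ← mul_assoc, dualWeight_mul_chi hψ hG (mem_filter.1 hC).2]

theorem h'_eq (x y : Vertex F D N) : h' D N x y 5 = h D N y x 5 := by
  simp only [h', h, Hxy, dist_comm x y]

theorem h_apply_left_eq_right (hk : (y - x).rank ≠ 0) (hkD : (y - x).rank < D) (hN : D < N - D) :
    h D N x y 5 x = h D N x y 5 y := by
  obtain ⟨ψ, hψ⟩ := exists_primitive_addChar F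
  obtain ⟨G, hG⟩ := exists_generalized_inverse (y - x)
  apply Complex.ofReal_injective
  rw [h_apply_eq_sum_chi hψ hG hk hkD hN, h_apply_eq_sum_chi hψ hG hk hkD hN]
  congr 1
  refine sum_congr rfl fun C hC => ?_
  rw [dualWeight_mul_chi hψ hG (mem_filter.1 hC).2, sub_self, chi_zero_right, mul_one]

theorem dualEigenvalue_rank (hD : 0 < D) (hN : 0 < N - D) (x y : Vertex F D N) :
    dualEigenvalue F D N (x - y).rank = dual F D N (x - y).rank := by
  have hex : ∃ p : Vertex F D N × Vertex F D N, dist F D N p.1 p.2 = (x - y).rank :=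
    ⟨(x, y), dist_eq_rank x y⟩
  have h := hex.choose_spec
  rw [dist_eq_rank] at h
  rw [dualEigenvalue, dif_pos hex, E_eq_idem hD hN, idem, h, mul_inv_cancel_left₀]
  exact Nat.cast_ne_zero.2 Fintype.card_ne_zero

/-- On each cell the distance to `y` is constant, equal to `k + ε(i)`, so the factor `|O_i|` becomes
a sum over the cell. -/
theorem lam_eq (hG : (y - x) * G * (y - x) = y - x) (hk : (y - x).rank ≠ 0)
    (hkD : (y - x).rank < D) (hN : D < N - D) (i : Fin 6) :
    lam D N x y i = (∑ p ∈ part D N x y i, (dual F D N 1 - dual F D N (y - p).rank)) /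
      (dual F D N 0 - dual F D N (y - x).rank) := by
  have e0 : dualEigenvalue F D N 0 = dual F D N 0 := by
    simpa using dualEigenvalue_rank (by omega) (by omega) x x
  have ek : dualEigenvalue F D N (y - x).rank = dual F D N (y - x).rank :=
    dualEigenvalue_rank (by omega) (by omega) y x
  rw [lam, dist_eq_rank, rank_sub_comm x y]
  simp only [e0, ek]
  congr 1
  rw [← nsmul_eq_mul, ← sum_const]
  refine sum_congr rfl fun p hp => ?_
  rw [mem_part_iff hG hk hkD hN] at hp
  obtain ⟨h1, h2⟩ := hp
  have e1 : dualEigenvalue F D N 1 = dual F D N 1 := by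
    have := dualEigenvalue_rank (by omega) (by omega) p x
    rwa [h1] at this
  have er : (![(y - x).rank - 1, (y - x).rank, (y - x).rank, (y - x).rank, (y - x).rank,
      (y - x).rank + 1] : Fin 6 → ℕ) i = (y - p).rank := by
    have hyp : y - p = (y - x) - (p - x) := by abel
    rw [hyp]
    rcases rank_sub_of_cls hG h1 with ⟨h3, h4⟩ | ⟨h3, h4⟩ | ⟨h3, h3', h4⟩
    · rw [← h2, h3]
      simp only [Matrix.cons_val]
      omega
    · rw [← h2, h3, h4]
      rfl
    · rw [h2] at h3 h3'
      rw [h4]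
      fin_cases i <;> simp at h3 h3' ⊢
  rw [e1, er, dualEigenvalue_rank (by omega) (by omega)]

/-- The numerator of `μ₆` is `|X| (h₆ x - h₆ y)`: every neighbour `p` of `x` contributes `θ*₁` at
`x` and the dual eigenvalue of its distance to `y` at `y`. -/
theorem mu_eq_zero (hk : (y - x).rank ≠ 0) (hkD : (y - x).rank < D) (hN : D < N - D) :
    mu D N x y 5 = 0 := by
  obtain ⟨G, hG⟩ := exists_generalized_inverse (y - x)
  have key := h_apply_left_eq_right hk hkD hN
  rw [h_apply hG hk hkD hN, h_apply hG hk hkD hN] at key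
  simp only [mu, lam_eq hG hk hkD hN, div_mul_eq_mul_div]
  rw [← sum_div, div_eq_zero_iff]
  left
  simp only [mul_comm _ (Hxy D N x y _ 5)]
  rw [sum_part hG hk hkD hN]
  simp only [mul_sub, sum_sub_distrib, sub_eq_zero]
  have hX : (Fintype.card (Vertex F D N) : ℝ) ≠ 0 := Nat.cast_ne_zero.2 Fintype.card_ne_zero
  refine mul_left_cancel₀ (inv_ne_zero hX) ?_
  rw [mul_sum, mul_sum]
  refine Eq.trans (sum_congr rfl fun B hB => ?_) (key.trans (sum_congr rfl fun B hB => ?_))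
  · rw [idem, rank_sub_comm, add_sub_cancel_left, (mem_filter.1 hB).2]
    ring
  · rw [idem]
    ring

theorem omega_eq_h (hk : (y - x).rank ≠ 0) (hkD : (y - x).rank < D) (hN : D < N - D) :
    omega D N x y = h D N x y 5 := by
  rw [omega, hCheck, mu_eq_zero hk hkD hN, zero_smul, sub_zero]

theorem omega_mem_symS (x y : Vertex F D N) : omega D N x y ∈ symS D N x y := by
  have e : omega D N x y = ∑ i, Hxy D N x y i 5 •
      (E F D N *ᵥ (hatSet (part D N x y i) - lam D N x y i • hat x)) := by
    rw [omega, hCheck, h, mu, sum_smul, ← sum_sub_distrib]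
    refine sum_congr rfl fun i _ => ?_
    rw [mulVec_sub, mulVec_smul, smul_sub, smul_smul, mul_comm (lam D N x y i)]
    rfl
  rw [e]
  exact Submodule.sum_mem _ fun i _ => Submodule.smul_mem _ _ (Submodule.subset_span ⟨i, rfl⟩)

theorem Ehat_apply (hD : 0 < D) (hN : 0 < N - D) (x z : Vertex F D N) :
    Ehat D N x z = idem F D N z x := by
  rw [Ehat, E_eq_idem hD hN]
  simp [hat]

/-- A product of characters is the character of the sum of their indices, and `E` keeps only those
of rank one. The coefficient at `C` is thus a sum of the dual weight over common neighbours of `0`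
and `C`. -/
theorem norton_Ehat_h (hk : (y - x).rank ≠ 0) (hkD : (y - x).rank < D) (hN : D < N - D) :
    norton (E F D N) (Ehat D N x) (h D N x y 5) =
      (-(Fintype.card F : ℝ) * (Fintype.card (Vertex F D N) : ℝ)⁻¹) • h D N x y 5 := by
  obtain ⟨ψ, hψ⟩ := exists_primitive_addChar F
  obtain ⟨G, hG⟩ := exists_generalized_inverse (y - x)
  funext z
  apply Complex.ofReal_injective
  have hE : ∀ w : Vertex F D N, ((Ehat D N x w : ℝ) : ℂ) = _ := fun w => by
    rw [Ehat_apply (by omega) (by omega), idem_apply hψ]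
  simp only [norton, mulVec, dotProduct, Pi.mul_apply, Pi.smul_apply, smul_eq_mul,
    E_eq_idem (F := F) (D := D) (N := N) (by omega) (by omega)]
  push_cast
  simp only [hE, h_apply_eq_sum_chi hψ hG hk hkD hN]
  set X : ℂ := (Fintype.card (Vertex F D N) : ℂ)
  set g := dualWeight ψ (y - x) G with hg
  -- Both character sums are multiplied out, separating the dependence on `w`, on which `E` acts.
  have e1 : ∀ w : Vertex F D N, (idem F D N z w : ℂ) *
      ((X⁻¹ * ∑ C : Vertex F D N with C.rank = 1, chi ψ C (w - x)) *
        (X⁻¹ * ∑ C : Vertex F D N with C.rank = 1, g C * chi ψ C (w - x))) =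
      X⁻¹ * X⁻¹ * ∑ B : Vertex F D N with B.rank = 1, ∑ C : Vertex F D N with C.rank = 1,
        g B * chi ψ (C + B) (-x) * ((idem F D N z w : ℂ) * chi ψ (C + B) w) := by
    intro w
    have e2 : ∑ B : Vertex F D N with B.rank = 1, ∑ C : Vertex F D N with C.rank = 1,
        g B * chi ψ (C + B) (-x) * ((idem F D N z w : ℂ) * chi ψ (C + B) w) =
        (idem F D N z w : ℂ) * ((∑ C : Vertex F D N with C.rank = 1, chi ψ C (w - x)) *
        ∑ C : Vertex F D N with C.rank = 1, g C * chi ψ C (w - x)) := by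
      rw [sum_mul_sum, sum_comm, mul_sum]
      refine sum_congr rfl fun C _ => ?_
      rw [mul_sum]
      refine sum_congr rfl fun B _ => ?_
      rw [sub_eq_add_neg, chi_add_right, chi_add_right, chi_add_left, chi_add_left]
      ring
    rw [e2]
    ring
  simp only [e1]
  rw [← mul_sum, sum_comm]
  have e3 : ∀ B ∈ ({B | B.rank = 1} : Finset (Vertex F D N)),
      ∑ w : Vertex F D N, ∑ C : Vertex F D N with C.rank = 1,
        g B * chi ψ (C + B) (-x) * ((idem F D N z w : ℂ) * chi ψ (C + B) w) =
      ∑ C : Vertex F D N with C.rank = 1,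
        if (C - B).rank = 1 then g B * chi ψ C (z - x) else 0 := by
    intro B _
    rw [sum_comm]
    simp only [← mul_sum, idem_mulVec_chi hψ]
    -- The new variable is the index `C + B` of the product character, whose rank must be one to
    -- survive `E`.
    rw [sum_filter, sum_filter, ← Equiv.sum_comp (Equiv.addRight B) fun C : Vertex F D N =>
      if C.rank = 1 then if (C - B).rank = 1 then g B * chi ψ C (z - x) else 0 else 0]
    refine sum_congr rfl fun C _ => ?_
    rw [Equiv.coe_addRight, add_sub_cancel_right, sub_eq_add_neg, chi_add_right]
    split_ifs <;> ring
  rw [sum_congr rfl e3, sum_comm]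
  have e4 : ∀ C ∈ ({C | C.rank = 1} : Finset (Vertex F D N)),
      (∑ B : Vertex F D N with B.rank = 1,
        if (C - B).rank = 1 then g B * chi ψ C (z - x) else 0) =
      -(Fintype.card F : ℂ) * (g C * chi ψ C (z - x)) := by
    intro C hC
    rw [← sum_filter, filter_filter, ← sum_mul, sum_neighbors_dualWeight hψ hG (mem_filter.1 hC).2,
      mul_assoc]
  rw [sum_congr rfl e4, ← mul_sum]
  ring

end Main

end BilForms

theorem proposition12p3 (F : Type*) [Field F] [Fintype F] (hq : Fintype.card F ≠ 2)
    (D N : ℕ) (hD : 3 ≤ D) (hN : 2 * D < N) (x y : BilForms.Vertex F D N)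
    (hk : 2 ≤ BilForms.dist F D N x y) (hkD : BilForms.dist F D N x y ≤ D - 1) :
    BilForms.omega D N x y = BilForms.h D N x y 5 ∧
    BilForms.omega D N x y = BilForms.h' D N x y 5 ∧
    BilForms.omega D N x y ∈ BilForms.symS D N x y ∧
    BilForms.omega D N x y = BilForms.omega D N y x ∧
    BilForms.norton (BilForms.E F D N) (BilForms.Ehat D N x) (BilForms.omega D N x y) =
      (-(Fintype.card F : ℝ) * (Fintype.card (BilForms.Vertex F D N) : ℝ)⁻¹) •
        BilForms.omega D N x y ∧
    BilForms.norton (BilForms.E F D N) (BilForms.Ehat D N y) (BilForms.omega D N x y) =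
      (-(Fintype.card F : ℝ) * (Fintype.card (BilForms.Vertex F D N) : ℝ)⁻¹) •
        BilForms.omega D N x y := by
  have hk' : (y - x).rank ≠ 0 := by
    rw [← BilForms.dist_eq_rank, BilForms.dist_comm]
    omega
  have hkD' : (y - x).rank < D := by
    rw [← BilForms.dist_eq_rank, BilForms.dist_comm]
    omega
  have hkr : (x - y).rank ≠ 0 := by rwa [BilForms.rank_sub_comm]
  have hkDr : (x - y).rank < D := by rwa [BilForms.rank_sub_comm]
  have hN' : D < N - D := by omega
  have h1 := BilForms.omega_eq_h hk' hkD' hN'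
  have h2 := BilForms.omega_eq_h hkr hkDr hN'
  have h3 := BilForms.h_swap hk' hkD' hN'
  refine ⟨h1, ?_, BilForms.omega_mem_symS x y, ?_, ?_, ?_⟩
  · rw [h1, BilForms.h'_eq, h3]
  · rw [h1, h2, h3]
  · rw [h1]
    exact BilForms.norton_Ehat_h hk' hkD' hN'
  -- After replacing `h₆` by its mirror image, this is the previous identity with `x` and `y`
  -- exchanged.
  · rw [h1, h3]
    exact BilForms.norton_Ehat_h hkr hkDr hN'
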